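/- Let $0\le\gamma<1$, $\delta>0$, and let $\kappa_1=\frac1{\delta+\gamma}$, $\kappa_2=1-\gamma$, $\lambda=\frac{\delta^2-\gamma}{(\delta+\gamma)^2}$. Let $b=0$, $d>0$, $a<0$, $c<0$, and put $c'=(1-\gamma)c$. Let $T>0$ and let $\mu>3/2$ be real. All functions of $x$ are $1$-periodic; $(f,g)=\int_0^1 f\bar g\,dx$ and $\|\cdot\|$ are the inner product and norm of $L^2(0,1)$, $\widehat v(k)=\int_0^1 v(x)e^{-2\pi i kx}dx$, and $H^s$ is the periodic Sobolev space with norm $\|v\|_s=\big(\sum_{k\in\mathbb Z}(1+k^2)^s|\widehat v(k)|^2\big)^{1/2}$. Let $\zeta,u\in C^1([0,T];H^\mu)$ be real-valued and solve, for $0\le t\le T$ and with $x$-derivatives in the sense of periodic distributions, $$\zeta_t+\kappa_1u_x+\lambda(\zeta u)_x+a\,u_{xxx}-b\,\zeta_{xxt}=0,\qquad u_t+\kappa_2\zeta_x+\lambda uu_x+c'\zeta_{xxx}-d\,u_{xxt}=0,$$ with $\zeta(\cdot,0)=\zeta_0$, $u(\cdot,0)=u_0$. For an integer $N\ge1$ let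 $S_N=\mathrm{span}_{\mathbb C}\{e^{2\pi ikx}:|k|\le N\}$, let $P_Nv=\sum_{|k|\le N}\widehat v(k)e^{2\pi ikx}$, and consider the Fourier-Galerkin semidiscretization: real-valued $\zeta_N,u_N:[0,T]\to S_N$, differentiable in $t$, with $\zeta_N(0)=P_N\zeta_0$, $u_N(0)=P_Nu_0$ and, for $0\le t\le T$ and all $\varphi,\chi\in S_N$, $$(\zeta_{Nt},\varphi)+\kappa_1(u_{Nx},\varphi)+\lambda((\zeta_Nu_N)_x,\varphi)+a(u_{Nxxx},\varphi)-b(\zeta_{Nxxt},\varphi)=0,$$ $$(u_{Nt},\chi)+\kappa_2(\zeta_{Nx},\chi)+\lambda(u_Nu_{Nx},\chi)+c'(\zeta_{Nxxx},\chi)-d(u_{Nxxt},\chi)=0.$$ Then there are a constant $C$ and an integer $N_0$, both independent of $N$, such that for every $N\ge1$ the semidiscrete problem has at most one solution on $[0,T]$, for every $N\ge \max(N_0,1)$ it has one, and for every $N\ge1$ for which the solution exists on $[0,T]$, $$\max_{0\le t\le T}\big(\|\zeta_N-\zeta\|+\|u_N-u\|_1\big)\le C\,N^{1-\mu}.$$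 The rate is of optimal order in $H^1$ for $u$ and, by one power of $N$, suboptimal in $L^2$ for $\zeta$, in the sense of comparison with the projection error: there is a constant $C$ such that $\|v-P_Nv\|_1\le CN^{1-\mu}\|v\|_\mu$ and $\|v-P_Nv\|\le CN^{-\mu}\|v\|_\mu$ for all real $v\in H^\mu$ and all $N\ge1$. -/

import Mathlib

open Set Filter Topology MeasureTheory
open scoped ContDiff ComplexConjugate

noncomputable section

namespace BoussinesqSpectral

/-! ### Periodic functions on `[0,1]`, Fourier coefficients, Sobolev norms -/

/-- The exponential `x ↦ e^{2πikx}` of period `1`. -/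
def expMode (k : ℤ) (x : ℝ) : ℂ :=
  Complex.exp (2 * Real.pi * Complex.I * k * x)

/-- The `L²(0,1)` pairing `(f, φ) = ∫₀¹ f φ̄ dx` of a real function `f` with a complex one. -/
def pairing (f : ℝ → ℝ) (φ : ℝ → ℂ) : ℂ :=
  ∫ x in (0 : ℝ)..1, (f x : ℂ) * conj (φ x)

/-- The `k`-th Fourier coefficient `∫₀¹ v(x) e^{-2πikx} dx`. -/
def fourierHat (v : ℝ → ℝ) (k : ℤ) : ℂ := pairing v (expMode k)

/-- The norm of `L²(0,1)`. -/
def l2Norm (v : ℝ → ℝ) : ℝ := Real.sqrt (∫ x in (0 : ℝ)..1, v x ^ 2)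

/-- Membership in the `L²`-based periodic Sobolev space `H^μ` on `[0,1]`. -/
structure MemSobolev (μ : ℝ) (v : ℝ → ℝ) : Prop where
  periodic : Function.Periodic v 1
  memLp : MemLp v 2 (volume.restrict (Ioc (0 : ℝ) 1))
  summable : Summable fun k : ℤ => (1 + (k : ℝ) ^ 2) ^ μ * ‖fourierHat v k‖ ^ 2

/-- The norm of `H^μ`, `(∑ₖ (1 + k²)^μ |v̂(k)|²)^{1/2}`. -/
def sobolevNorm (μ : ℝ) (v : ℝ → ℝ) : ℝ :=
  Real.sqrt (∑' k : ℤ, (1 + (k : ℝ) ^ 2) ^ μ * ‖fourierHat v k‖ ^ 2)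

/-- `g ∈ C¹([0,T]; H^μ)` with time derivative `g'`: the difference quotients converge in the
norm of `H^μ` at every time of `[0,T]` (one-sided at the end points), and `g'` is continuous
in that norm. -/
structure IsC1Sobolev (T μ : ℝ) (g g' : ℝ → ℝ → ℝ) : Prop where
  mem : ∀ t ∈ Icc 0 T, MemSobolev μ (g t)
  mem_deriv : ∀ t ∈ Icc 0 T, MemSobolev μ (g' t)
  hasDeriv : ∀ t ∈ Icc 0 T,
    Tendsto (fun s => sobolevNorm μ (fun x => (s - t)⁻¹ * (g s x - g t x) - g' t x))
      (𝓝[Icc 0 T \ {t}] t) (𝓝 0)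
  continuous_deriv : ∀ t ∈ Icc 0 T,
    Tendsto (fun s => sobolevNorm μ (fun x => g' s x - g' t x)) (𝓝[Icc 0 T] t) (𝓝 0)

/-! ### The trigonometric polynomials and the projection onto them -/

/-- `S_N`, the span of the exponentials `e^{2πikx}`, `|k| ≤ N`. -/
def trigSpace (N : ℕ) : Submodule ℂ (ℝ → ℂ) :=
  Submodule.span ℂ {f | ∃ k : ℤ, |k| ≤ (N : ℤ) ∧ f = expMode k}

/-- The `L²` projection `P_N v = ∑_{|k| ≤ N} v̂(k) e^{2πikx}` of a real function `v`, as a real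
function; the sum is real, see `ofReal_trigProj`. -/
def trigProj (N : ℕ) (v : ℝ → ℝ) (x : ℝ) : ℝ :=
  (∑ k ∈ Finset.Icc (-(N : ℤ)) N, fourierHat v k * expMode k x).re

theorem conj_expMode (k : ℤ) (x : ℝ) : conj (expMode k x) = expMode (-k) x := by
  unfold expMode
  rw [← Complex.exp_conj]
  congr 1
  have h2 : conj (2 : ℂ) = 2 := Complex.conj_ofNat 2
  simp only [map_mul, h2, Complex.conj_ofReal, Complex.conj_I, map_intCast, Int.cast_neg]
  ring

theorem conj_fourierHat (v : ℝ → ℝ) (k : ℤ) : conj (fourierHat v k) = fourierHat v (-k) := by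
  unfold fourierHat pairing
  rw [intervalIntegral.integral_of_le zero_le_one, intervalIntegral.integral_of_le zero_le_one,
    ← integral_conj]
  congr 1
  funext x
  rw [map_mul, Complex.conj_ofReal, conj_expMode k x]

theorem ofReal_trigProj (N : ℕ) (v : ℝ → ℝ) (x : ℝ) :
    (trigProj N v x : ℂ) = ∑ k ∈ Finset.Icc (-(N : ℤ)) N, fourierHat v k * expMode k x := by
  unfold trigProj
  apply Complex.conj_eq_iff_re.mp
  rw [map_sum]
  refine Finset.sum_nbij' (fun k => -k) (fun k => -k) ?_ ?_ ?_ ?_ ?_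
  · intro k hk; simp only [Finset.mem_Icc] at hk ⊢; omega
  · intro k hk; simp only [Finset.mem_Icc] at hk ⊢; omega
  · intro k _; simp
  · intro k _; simp
  · intro k _
    rw [map_mul, conj_fourierHat, conj_expMode]

/-! ### The Boussinesq/Boussinesq system and its semidiscretization -/

/-- `κ₁ = 1 / (δ + γ)`. -/
def kappa₁ (γ δ : ℝ) : ℝ := 1 / (δ + γ)

/-- `κ₂ = 1 - γ`. -/
def kappa₂ (γ : ℝ) : ℝ := 1 - γ

/-- `λ = (δ² - γ) / (δ + γ)²`. -/
def lam (γ δ : ℝ) : ℝ := (δ ^ 2 - γ) / (δ + γ) ^ 2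

/-- `c' = (1 - γ) c`. -/
def cPrime (γ c : ℝ) : ℝ := (1 - γ) * c

/-- The pair `(ζ, u)`, with time derivatives `(ζt, ut)`, satisfies for `0 ≤ t ≤ T`
`ζ_t + κ₁ u_x + λ (ζ u)_x + a u_xxx - b ζ_xxt = 0`,
`u_t + κ₂ ζ_x + λ u u_x + c' ζ_xxx - d u_xxt = 0`,
the `x`-derivatives being those of periodic distributions (with `u u_x = (u²)_x / 2`), and
has the initial values `(ζ₀, u₀)`. -/
structure IsSolution (γ δ a b c d T : ℝ) (ζ₀ u₀ : ℝ → ℝ) (ζ u ζt ut : ℝ → ℝ → ℝ) : Prop where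
  eq_fst : ∀ t ∈ Icc 0 T, ∀ φ : ℝ → ℂ, ContDiff ℝ ∞ φ → Function.Periodic φ 1 →
    pairing (ζt t) φ
      - kappa₁ γ δ * pairing (u t) (deriv φ)
      - lam γ δ * pairing (fun x => ζ t x * u t x) (deriv φ)
      - a * pairing (u t) (iteratedDeriv 3 φ)
      - b * pairing (ζt t) (iteratedDeriv 2 φ) = 0
  eq_snd : ∀ t ∈ Icc 0 T, ∀ χ : ℝ → ℂ, ContDiff ℝ ∞ χ → Function.Periodic χ 1 →
    pairing (ut t) χ
      - kappa₂ γ * pairing (ζ t) (deriv χ)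
      - lam γ δ * pairing (fun x => u t x ^ 2 / 2) (deriv χ)
      - cPrime γ c * pairing (ζ t) (iteratedDeriv 3 χ)
      - d * pairing (ut t) (iteratedDeriv 2 χ) = 0
  init_fst : ∀ᵐ x : ℝ, ζ 0 x = ζ₀ x
  init_snd : ∀ᵐ x : ℝ, u 0 x = u₀ x

/-- The time derivative on `[0,T]` (one-sided at the end points). -/
def timeDeriv (T : ℝ) (v : ℝ → ℝ → ℝ) (t x : ℝ) : ℝ :=
  derivWithin (fun s => v s x) (Icc 0 T) t

/-- The real-valued pair `(ζN, uN) : [0,T] → S_N × S_N` solves the spectral Fourier-Galerkin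
semidiscretization on `[0,T]`. -/
structure IsGalerkinSolution (γ δ a b c d T : ℝ) (ζ₀ u₀ : ℝ → ℝ) (N : ℕ)
    (ζN uN : ℝ → ℝ → ℝ) : Prop where
  mem_fst : ∀ t ∈ Icc 0 T, (fun x => (ζN t x : ℂ)) ∈ trigSpace N
  mem_snd : ∀ t ∈ Icc 0 T, (fun x => (uN t x : ℂ)) ∈ trigSpace N
  diff_fst : ∀ x, DifferentiableOn ℝ (fun t => ζN t x) (Icc 0 T)
  diff_snd : ∀ x, DifferentiableOn ℝ (fun t => uN t x) (Icc 0 T)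
  eq_fst : ∀ t ∈ Icc 0 T, ∀ φ ∈ trigSpace N,
    pairing (timeDeriv T ζN t) φ
      + kappa₁ γ δ * pairing (deriv (uN t)) φ
      + lam γ δ * pairing (deriv fun x => ζN t x * uN t x) φ
      + a * pairing (iteratedDeriv 3 (uN t)) φ
      - b * pairing (iteratedDeriv 2 (timeDeriv T ζN t)) φ = 0
  eq_snd : ∀ t ∈ Icc 0 T, ∀ χ ∈ trigSpace N,
    pairing (timeDeriv T uN t) χ
      + kappa₂ γ * pairing (deriv (ζN t)) χ
      + lam γ δ * pairing (fun x => uN t x * deriv (uN t) x) χ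
      + cPrime γ c * pairing (iteratedDeriv 3 (ζN t)) χ
      - d * pairing (iteratedDeriv 2 (timeDeriv T uN t)) χ = 0
  init_fst : ζN 0 = trigProj N ζ₀
  init_snd : uN 0 = trigProj N u₀

end BoussinesqSpectral

end

open BoussinesqSpectral

noncomputable section

namespace BoussinesqSpectral

/-! ### Fourier coefficients on the unit interval -/

/-! In Fourier variables the system reads `Z' = -2πik (α U + λ Z * U)`, `U' = -(2πik / D) (β Z +
(λ/2) U * U)`, with `*` the convolution and symbols `α`, `β`, `D` that are positive and grow like
`k²` because `a, c < 0 < d`. The Galerkin coefficients `z`, `w` solve the same equations for `|k| ≤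
N` and vanish elsewhere. The error is measured by the energy `∑_{|k| ≤ N} (|Z - z|² + (α D / β) |U -
w|²)`. The weight `α D / β` symmetrizes the linear part, whose contribution cancels exactly
(`energyRate_eq`), and it dominates `(1 + |k|)²`, so the energy controls the error in `L² × H¹`.

In the nonlinear part of the first equation, `ZU - zw = Z f + w q + θ w`, where `f = U - w`, `θ` is
the error of `ζ` in the modes `|k| ≤ N` and `q` is the tail of `Z`. The first two products are
estimated in `H¹`: `H^μ` with `μ > 3/2` embeds into `ℓ¹` with weight `1 + |k|`, which acts on `H¹`
by multiplication. The `H¹` norm of `q` costs `N^{1-μ}`, and this is where `ζ` loses a power of `N`.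
The product `θ w` would need a derivative of `θ`, but transport by a real `w` is antisymmetric up to
a term of order zero (`abs_re_transport_le`). Together these give `sum_energyRate_le`.

That estimate involves the weighted `ℓ¹` norm of `w`, which is not known in advance. By
Cauchy-Schwarz over `2N + 1` modes it exceeds that of `U` by at most `1` as long as `N` times the
energy is small (`tsum_wt_approx_le`). The barrier `N^{2(1-μ)} e^{κt}` has this smallness for large
`N`, since `2(1-μ) + 1 < 0`. The energy starts at zero, and it stays below the barrier because it
grows strictly more slowly wherever the two meet (`energy_le`).

Only the meeting times matter, so the argument also applies to a vector field cut off outside a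
large ball. Its global solution never leaves the region where the cutoff is `1`, hence solves the
semidiscrete problem (`exists_isCoeffSolution`). Uniqueness is that of a smooth system of ordinary
differential equations. The finitely many remaining `N` have at most one solution each, and their
error bounds are absorbed into the constant. -/

theorem expMode_eq_fourier (k : ℤ) (x : ℝ) :
    expMode k x = fourier k (x : AddCircle (1 : ℝ)) := by
  rw [fourier_coe_apply, expMode]
  simp

theorem expMode_add (j k : ℤ) (x : ℝ) : expMode (j + k) x = expMode j x * expMode k x := by
  unfold expMode
  rw [← Complex.exp_add]
  congr 1
  push_cast
  ring

theorem norm_expMode (k : ℤ) (x : ℝ) : ‖expMode k x‖ = 1 := by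
  rw [expMode_eq_fourier]
  exact Circle.norm_coe _

theorem contDiff_expMode (k : ℤ) : ContDiff ℝ ∞ (expMode k) := by
  unfold expMode
  have : ContDiff ℝ ∞ (fun x : ℝ => (x : ℂ)) := Complex.ofRealCLM.contDiff
  fun_prop

theorem continuous_expMode (k : ℤ) : Continuous (expMode k) := (contDiff_expMode k).continuous

theorem periodic_expMode (k : ℤ) : Function.Periodic (expMode k) 1 := by
  intro x
  rw [expMode_eq_fourier, expMode_eq_fourier]
  congr 1
  simp

theorem hasDerivAt_expMode (k : ℤ) (x : ℝ) :
    HasDerivAt (expMode k) (2 * Real.pi * Complex.I * k * expMode k x) x := by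
  have h := hasDerivAt_fourier 1 k x
  simp only [← expMode_eq_fourier, Complex.ofReal_one, div_one] at h
  exact h

theorem deriv_expMode (k : ℤ) :
    deriv (expMode k) = fun x => 2 * Real.pi * Complex.I * k * expMode k x :=
  funext fun x => (hasDerivAt_expMode k x).deriv

theorem iteratedDeriv_expMode (n : ℕ) (k : ℤ) :
    iteratedDeriv n (expMode k) = fun x => (2 * Real.pi * Complex.I * k) ^ n * expMode k x := by
  induction n with
  | zero => simp
  | succ n ih =>
    rw [iteratedDeriv_succ, ih]
    funext x
    rw [((hasDerivAt_expMode k x).const_mul _).deriv]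
    ring

theorem memLp_mul_expMode {f : ℝ → ℂ} {s : Set ℝ} (hf : MemLp f 2 (volume.restrict s)) (k : ℤ) :
    MemLp (fun x => f x * expMode k x) 2 (volume.restrict s) := by
  refine hf.congr_norm (hf.1.mul (continuous_expMode k).aestronglyMeasurable) ?_
  filter_upwards with x
  rw [norm_mul, norm_expMode, mul_one]

/-- The bridge to Fourier series on `AddCircle`, through which Parseval's identity is imported. -/
theorem fourierCoeff_liftIoc (f : ℝ → ℂ) (k : ℤ) :
    fourierCoeff (AddCircle.liftIoc 1 0 f) k = ∫ x in (0 : ℝ)..1, f x * conj (expMode k x) := by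
  rw [fourierCoeff_liftIoc_eq, fourierCoeffOn_eq_integral]
  simp only [zero_add, sub_zero, div_one, one_smul]
  refine intervalIntegral.integral_congr fun x _ => ?_
  rw [conj_expMode, smul_eq_mul, fourier_coe_apply, expMode, mul_comm]
  simp

theorem memLp_ofReal {f : ℝ → ℝ} {m : Measure ℝ} (hf : MemLp f 2 m) :
    MemLp (fun x => (f x : ℂ)) 2 m := hf.ofReal

/-- Parseval's identity in its bilinear form. -/
theorem hasSum_parseval {f g : ℝ → ℂ} (hf : MemLp f 2 (volume.restrict (Ioc (0 : ℝ) 1)))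
    (hg : MemLp g 2 (volume.restrict (Ioc (0 : ℝ) 1))) :
    HasSum (fun j : ℤ => conj (∫ x in (0 : ℝ)..1, f x * conj (expMode j x)) *
      ∫ x in (0 : ℝ)..1, g x * conj (expMode j x)) (∫ x in (0 : ℝ)..1, conj (f x) * g x) := by
  have hf' : MemLp (AddCircle.liftIoc 1 0 f) 2 AddCircle.haarAddCircle := by
    refine MemLp.haarAddCircle (MemLp.memLp_liftIoc ?_)
    simpa using hf
  have hg' : MemLp (AddCircle.liftIoc 1 0 g) 2 AddCircle.haarAddCircle := by
    refine MemLp.haarAddCircle (MemLp.memLp_liftIoc ?_)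
    simpa using hg
  have h := (fourierBasis (T := (1 : ℝ))).hasSum_inner_mul_inner hf'.toLp hg'.toLp
  have e1 : ∀ j, inner ℂ (fourierBasis (T := (1 : ℝ)) j) hg'.toLp
      = ∫ x in (0 : ℝ)..1, g x * conj (expMode j x) := fun j => by
    rw [← HilbertBasis.repr_apply_apply, fourierBasis_repr,
      fourierCoeff_congr_ae hg'.coeFn_toLp, fourierCoeff_liftIoc]
  have e2 : ∀ j, inner ℂ hf'.toLp (fourierBasis (T := (1 : ℝ)) j)
      = conj (∫ x in (0 : ℝ)..1, f x * conj (expMode j x)) := fun j => by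
    rw [← inner_conj_symm, ← HilbertBasis.repr_apply_apply, fourierBasis_repr,
      fourierCoeff_congr_ae hf'.coeFn_toLp, fourierCoeff_liftIoc]
  have e3 : inner ℂ hf'.toLp hg'.toLp = ∫ x in (0 : ℝ)..1, conj (f x) * g x := by
    rw [L2.inner_def]
    have : ∫ t : AddCircle (1 : ℝ), inner ℂ ((hf'.toLp : AddCircle (1 : ℝ) → ℂ) t)
          ((hg'.toLp : AddCircle (1 : ℝ) → ℂ) t) ∂AddCircle.haarAddCircle
        = ∫ t : AddCircle (1 : ℝ), AddCircle.liftIoc 1 0 (fun x => conj (f x) * g x) t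
          ∂AddCircle.haarAddCircle := by
      refine integral_congr_ae ?_
      filter_upwards [hf'.coeFn_toLp, hg'.coeFn_toLp] with t h1 h2
      rw [h1, h2, RCLike.inner_apply, mul_comm]
      rfl
    rw [this, AddCircle.integral_haarAddCircle, AddCircle.integral_liftIoc_eq_intervalIntegral]
    simp
  simp only [e1, e2, e3] at h
  exact h

/-- Parseval for `f` and `g e^{-2πikx}`, reindexed by `j ↦ -j`; since `f` is real, the conjugate of
its coefficient at `-j` is the one at `j`. -/
theorem hasSum_fourierHat_mul {f g : ℝ → ℝ} (hf : MemLp f 2 (volume.restrict (Ioc (0 : ℝ) 1)))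
    (hg : MemLp g 2 (volume.restrict (Ioc (0 : ℝ) 1))) (k : ℤ) :
    HasSum (fun j : ℤ => fourierHat f j * fourierHat g (k - j))
      (fourierHat (fun x => f x * g x) k) := by
  have h := hasSum_parseval (memLp_ofReal hf) (memLp_mul_expMode (memLp_ofReal hg) (-k))
  rw [← (Equiv.neg ℤ).hasSum_iff] at h
  convert h using 1
  · funext j
    simp only [Function.comp, Equiv.neg_apply]
    congr 1
    · rw [← neg_neg j, ← conj_fourierHat, neg_neg]; rfl
    · unfold fourierHat pairing
      refine intervalIntegral.integral_congr fun x _ => ?_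
      simp only [conj_expMode]
      rw [mul_assoc, ← expMode_add]
      congr 2
      ring
  · unfold fourierHat pairing
    refine intervalIntegral.integral_congr fun x _ => ?_
    simp only [conj_expMode, Complex.conj_ofReal, Complex.ofReal_mul]
    ring

theorem hasSum_norm_fourierHat_sq {f : ℝ → ℝ}
    (hf : MemLp f 2 (volume.restrict (Ioc (0 : ℝ) 1))) :
    HasSum (fun j : ℤ => ‖fourierHat f j‖ ^ 2) (∫ x in (0 : ℝ)..1, f x ^ 2) := by
  have h := hasSum_parseval (memLp_ofReal hf) (memLp_ofReal hf)
  rw [← Complex.hasSum_ofReal]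
  convert h using 1
  · funext j
    rw [← Complex.normSq_eq_norm_sq, Complex.normSq_eq_conj_mul_self]
    rfl
  · rw [← intervalIntegral.integral_ofReal]
    refine intervalIntegral.integral_congr fun x _ => ?_
    simp only [Complex.conj_ofReal]
    push_cast
    ring

theorem intervalIntegrable_of_memLp {f : ℝ → ℝ}
    (hf : MemLp f 2 (volume.restrict (Ioc (0 : ℝ) 1))) : IntervalIntegrable f volume 0 1 := by
  rw [intervalIntegrable_iff_integrableOn_Ioc_of_le zero_le_one]
  exact hf.integrable (by norm_num)

theorem IntervalIntegrable.pairing {f : ℝ → ℝ} (hf : IntervalIntegrable f volume 0 1)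
    {φ : ℝ → ℂ} (hφ : Continuous φ) :
    IntervalIntegrable (fun x => (f x : ℂ) * conj (φ x)) volume 0 1 :=
  IntervalIntegrable.mul_continuousOn (f := fun x => (f x : ℂ))
    ⟨hf.1.ofReal, hf.2.ofReal⟩ (Complex.continuous_conj.comp hφ).continuousOn

theorem pairing_smul_left (c : ℝ) (f : ℝ → ℝ) (φ : ℝ → ℂ) :
    pairing (fun x => c * f x) φ = c * pairing f φ := by
  unfold pairing
  rw [← intervalIntegral.integral_const_mul]
  refine intervalIntegral.integral_congr fun x _ => ?_
  push_cast
  ring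

theorem pairing_sub_left {f g : ℝ → ℝ} (hf : IntervalIntegrable f volume 0 1)
    (hg : IntervalIntegrable g volume 0 1) {φ : ℝ → ℂ} (hφ : Continuous φ) :
    pairing (fun x => f x - g x) φ = pairing f φ - pairing g φ := by
  unfold pairing
  rw [← intervalIntegral.integral_sub (IntervalIntegrable.pairing hf hφ)
    (IntervalIntegrable.pairing hg hφ)]
  refine intervalIntegral.integral_congr fun x _ => ?_
  push_cast
  ring

theorem pairing_smul_right (c : ℂ) (f : ℝ → ℝ) (φ : ℝ → ℂ) :
    pairing f (c • φ) = conj c * pairing f φ := by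
  unfold pairing
  rw [← intervalIntegral.integral_const_mul]
  refine intervalIntegral.integral_congr fun x _ => ?_
  simp only [Pi.smul_apply, smul_eq_mul, map_mul]
  ring

theorem fourierHat_congr_ae {f g : ℝ → ℝ} (h : ∀ᵐ x : ℝ, f x = g x) (k : ℤ) :
    fourierHat f k = fourierHat g k := by
  unfold fourierHat pairing
  refine intervalIntegral.integral_congr_ae ?_
  filter_upwards [h] with x hx _
  rw [hx]

theorem integral_expMode (k : ℤ) :
    ∫ x in (0 : ℝ)..1, expMode k x = if k = 0 then 1 else 0 := by
  have h := congrFun (fourierCoeff_fourier (T := (1 : ℝ)) 0) (-k)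
  rw [fourierCoeff_eq_intervalIntegral _ _ 0] at h
  simp only [neg_neg, ← expMode_eq_fourier, smul_eq_mul, zero_add, div_one, one_smul] at h
  have h0 : ∀ x, expMode 0 x = 1 := fun x => by simp [expMode]
  simp only [h0, mul_one] at h
  rw [h, Pi.single_apply]
  simp

/-- The Fourier coefficients of a real trigonometric polynomial. -/
theorem fourierHat_of_eq_sum {v : ℝ → ℝ} {s : Finset ℤ} {z : ℤ → ℂ}
    (h : ∀ x, (v x : ℂ) = ∑ j ∈ s, z j * expMode j x) (k : ℤ) :
    fourierHat v k = if k ∈ s then z k else 0 := by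
  unfold fourierHat pairing
  have : ∀ x : ℝ, (v x : ℂ) * conj (expMode k x) = ∑ j ∈ s, z j * expMode (j - k) x := fun x => by
    rw [h, Finset.sum_mul, conj_expMode]
    refine Finset.sum_congr rfl fun j _ => ?_
    rw [sub_eq_add_neg, expMode_add, mul_assoc]
  simp only [this]
  rw [intervalIntegral.integral_finsetSum (f := fun j x => z j * expMode (j - k) x) fun j _ =>
    (continuous_const.mul (continuous_expMode _)).intervalIntegrable _ _]
  simp only [intervalIntegral.integral_const_mul, integral_expMode, sub_eq_zero, mul_ite, mul_one,
    mul_zero]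
  rw [Finset.sum_ite_eq']

/-- Integration by parts for the Fourier coefficients of a periodic `C¹` function. -/
theorem fourierHat_deriv {f : ℝ → ℝ} (hf : ContDiff ℝ 1 f) (hp : Function.Periodic f 1) (k : ℤ) :
    fourierHat (deriv f) k = 2 * Real.pi * Complex.I * k * fourierHat f k := by
  have hd : ∀ x : ℝ, HasDerivAt (fun x => (f x : ℂ)) ((deriv f x : ℝ) : ℂ) x := fun x =>
    ((hf.differentiable one_ne_zero) x).hasDerivAt.ofReal_comp
  have he : ∀ x : ℝ, HasDerivAt (fun x => expMode (-k) x)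
      (2 * Real.pi * Complex.I * ((-k : ℤ) : ℂ) * expMode (-k) x) x := hasDerivAt_expMode (-k)
  have hc : Continuous fun x => ((deriv f x : ℝ) : ℂ) :=
    Complex.continuous_ofReal.comp (hf.continuous_deriv le_rfl)
  have h := intervalIntegral.integral_mul_deriv_eq_deriv_mul (a := 0) (b := 1)
    (fun x _ => hd x) (fun x _ => he x) (hc.intervalIntegrable _ _)
    ((continuous_const.mul (continuous_expMode _)).intervalIntegrable _ _)
  have e1 : f 1 = f 0 := by simpa using hp 0
  have e2 : expMode (-k) 1 = expMode (-k) 0 := by simpa using periodic_expMode (-k) 0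
  rw [e1, e2, sub_self, zero_sub] at h
  unfold fourierHat pairing
  simp only [conj_expMode]
  rw [← neg_eq_iff_eq_neg] at h
  rw [← h, ← intervalIntegral.integral_const_mul, ← intervalIntegral.integral_neg]
  refine intervalIntegral.integral_congr fun x _ => ?_
  push_cast
  ring

theorem periodic_deriv {f : ℝ → ℝ} (hp : Function.Periodic f 1) :
    Function.Periodic (deriv f) 1 := by
  intro x
  rw [← deriv_comp_add_const]
  congr 1
  exact funext hp

theorem periodic_iteratedDeriv {f : ℝ → ℝ} (hp : Function.Periodic f 1) (n : ℕ) :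
    Function.Periodic (iteratedDeriv n f) 1 := by
  induction n with
  | zero => simpa using hp
  | succ n ih => rw [iteratedDeriv_succ]; exact periodic_deriv ih

theorem fourierHat_iteratedDeriv {f : ℝ → ℝ} (hf : ContDiff ℝ ∞ f) (hp : Function.Periodic f 1)
    (n : ℕ) (k : ℤ) :
    fourierHat (iteratedDeriv n f) k = (2 * Real.pi * Complex.I * k) ^ n * fourierHat f k := by
  induction n with
  | zero => simp
  | succ n ih =>
    rw [iteratedDeriv_succ, fourierHat_deriv _ (periodic_iteratedDeriv hp n), ih]
    · ring
    · rw [iteratedDeriv_eq_iterate]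
      exact ContDiff.iterate_deriv' 1 n (hf.of_le (by exact_mod_cast le_top))

/-! ### Weighted sequences and convolutions -/

/-- The modes `|k| ≤ N` of `S_N`. -/
abbrev modes (N : ℕ) : Finset ℤ := Finset.Icc (-(N : ℤ)) N

/-- The convolution of two sequences indexed by `ℤ`. -/
def conv (f g : ℤ → ℂ) (k : ℤ) : ℂ := ∑' j : ℤ, f j * g (k - j)

/-- The weight `1 + |k|`. -/
def wt (k : ℤ) : ℝ := 1 + |(k : ℝ)|

theorem one_le_wt (k : ℤ) : 1 ≤ wt k := le_add_of_nonneg_right (abs_nonneg _)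

theorem wt_nonneg (k : ℤ) : 0 ≤ wt k := zero_le_one.trans (one_le_wt k)

theorem abs_le_wt (k : ℤ) : |(k : ℝ)| ≤ wt k := le_add_of_nonneg_left zero_le_one

/-- Submultiplicativity lets the weight be distributed over the two factors of a convolution, so
that the weighted estimates reduce to Young's inequality. -/
theorem wt_le_mul (j k : ℤ) : wt k ≤ wt j * wt (k - j) := by
  unfold wt
  have h : |(k : ℝ)| ≤ |(j : ℝ)| + |((k - j : ℤ) : ℝ)| := by
    refine le_trans (le_of_eq ?_) (abs_add_le _ _)
    congr 1
    push_cast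
    ring
  nlinarith [abs_nonneg (j : ℝ), abs_nonneg ((k - j : ℤ) : ℝ),
    mul_nonneg (abs_nonneg (j : ℝ)) (abs_nonneg ((k - j : ℤ) : ℝ))]

theorem conv_comm (f g : ℤ → ℂ) (k : ℤ) : conv f g k = conv g f k := by
  unfold conv
  rw [← (Equiv.subLeft k).tsum_eq]
  refine tsum_congr fun j => ?_
  simp [mul_comm]

theorem sum_comp_sub_right_le_tsum {a : ℤ → ℝ} (ha : ∀ j, 0 ≤ a j) (hs : Summable a)
    (I : Finset ℤ) (k : ℤ) : ∑ j ∈ I, a (j - k) ≤ ∑' j, a j := by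
  have h : Summable fun j => a (j - k) := (Equiv.subRight k).summable_iff.mpr hs
  rw [← (Equiv.subRight k).tsum_eq a]
  exact h.sum_le_tsum I fun j _ => ha _

theorem sum_comp_sub_left_le_tsum {a : ℤ → ℝ} (ha : ∀ j, 0 ≤ a j) (hs : Summable a)
    (I : Finset ℤ) (k : ℤ) : ∑ j ∈ I, a (k - j) ≤ ∑' j, a j := by
  have h : Summable fun j => a (k - j) := (Equiv.subLeft k).summable_iff.mpr hs
  rw [← (Equiv.subLeft k).tsum_eq a]
  exact h.sum_le_tsum I fun j _ => ha _

theorem summable_mul_comp_sub {a b : ℤ → ℝ} (ha : ∀ j, 0 ≤ a j) (hb : ∀ j, 0 ≤ b j)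
    (hsa : Summable a) (hsb : Summable fun j => b j ^ 2) (k : ℤ) :
    Summable fun j => a j * b (k - j) := by
  refine Summable.of_nonneg_of_le (fun j => mul_nonneg (ha j) (hb _)) (fun j => ?_)
    (hsa.mul_right (1 + ∑' j, b j ^ 2))
  refine mul_le_mul_of_nonneg_left ?_ (ha j)
  -- A square summable sequence is bounded: `b ≤ 1 + b² ≤ 1 + ∑ b²`.
  have := hsb.le_tsum (k - j) fun i _ => sq_nonneg (b i)
  nlinarith [sq_nonneg (b (k - j) - 1)]

/-- Young's inequality `ℓ¹ * ℓ² ⊆ ℓ²`, in a dual form. -/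
theorem sum_mul_tsum_le {a b c : ℤ → ℝ} (ha : ∀ j, 0 ≤ a j) (hb : ∀ j, 0 ≤ b j)
    (hsa : Summable a) (hsb : Summable fun j => b j ^ 2) (I : Finset ℤ) :
    ∑ k ∈ I, c k * ∑' j, a j * b (k - j)
      ≤ (∑' j, a j) / 2 * (∑ k ∈ I, c k ^ 2 + ∑' j, b j ^ 2) := by
  have hs := summable_mul_comp_sub ha hb hsa hsb
  simp only [← tsum_mul_left]
  rw [← Summable.tsum_finsetSum fun k _ => (hs k).mul_left (c k), mul_comm (_ / 2),
    ← mul_div_assoc, ← div_mul_eq_mul_div, ← tsum_mul_left]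
  refine Summable.tsum_le_tsum (fun j => ?_) (summable_sum fun k _ => (hs k).mul_left (c k))
    (hsa.mul_left _)
  -- For fixed `j`, the inequality of arithmetic and geometric means followed by translation
  -- invariance of `∑ b²`. The result is additive in the two squares, which is the form the energy
  -- estimate uses.
  have h1 : ∑ k ∈ I, c k * (a j * b (k - j)) ≤ ∑ k ∈ I, (c k ^ 2 + b (k - j) ^ 2) / 2 * a j :=
    Finset.sum_le_sum fun k _ => by nlinarith [mul_nonneg (ha j) (sq_nonneg (c k - b (k - j)))]
  have h2 := sum_comp_sub_right_le_tsum (fun j => sq_nonneg (b j)) hsb I j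
  rw [← Finset.sum_mul, ← Finset.sum_div, Finset.sum_add_distrib] at h1
  exact h1.trans (mul_le_mul_of_nonneg_right (by linarith) (ha j))

/-- Membership in the weighted `ℓ¹` space with weight `1 + |k|`. -/
def MemW1 (A : ℤ → ℂ) : Prop := Summable fun k => wt k * ‖A k‖

/-- Membership in the weighted `ℓ²` space with weight `1 + |k|`. -/
def MemH1 (A : ℤ → ℂ) : Prop := Summable fun k => (wt k * ‖A k‖) ^ 2

theorem wt_mul_norm_nonneg (A : ℤ → ℂ) (k : ℤ) : 0 ≤ wt k * ‖A k‖ :=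
  mul_nonneg (wt_nonneg k) (norm_nonneg _)

theorem norm_conv_term_le (A f : ℤ → ℂ) (j k : ℤ) :
    wt k * ‖A j * f (k - j)‖ ≤ wt j * ‖A j‖ * (wt (k - j) * ‖f (k - j)‖) := by
  rw [norm_mul]
  have := mul_le_mul_of_nonneg_right (wt_le_mul j k)
    (mul_nonneg (norm_nonneg (A j)) (norm_nonneg (f (k - j))))
  linarith

theorem summable_conv {A f : ℤ → ℂ} (hA : MemW1 A) (hf : MemH1 f) (k : ℤ) :
    Summable fun j => A j * f (k - j) := by
  refine Summable.of_norm_bounded (summable_mul_comp_sub (wt_mul_norm_nonneg A)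
    (wt_mul_norm_nonneg f) hA hf k) fun j => ?_
  refine le_trans ?_ (norm_conv_term_le A f j k)
  exact le_mul_of_one_le_left (norm_nonneg _) (one_le_wt k)

theorem wt_mul_norm_conv_le {A f : ℤ → ℂ} (hA : MemW1 A) (hf : MemH1 f) (k : ℤ) :
    wt k * ‖conv A f k‖ ≤ ∑' j, wt j * ‖A j‖ * (wt (k - j) * ‖f (k - j)‖) := by
  have hs := summable_mul_comp_sub (wt_mul_norm_nonneg A) (wt_mul_norm_nonneg f) hA hf k
  have hn : Summable fun j => wt k * ‖A j * f (k - j)‖ :=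
    Summable.of_nonneg_of_le (fun j => mul_nonneg (wt_nonneg k) (norm_nonneg _))
      (fun j => norm_conv_term_le A f j k) hs
  calc wt k * ‖conv A f k‖ ≤ wt k * ∑' j, ‖A j * f (k - j)‖ :=
        mul_le_mul_of_nonneg_left (norm_tsum_le_tsum_norm (summable_conv hA hf k).norm) (wt_nonneg k)
    _ = ∑' j, wt k * ‖A j * f (k - j)‖ := tsum_mul_left.symm
    _ ≤ _ := hn.tsum_le_tsum (fun j => norm_conv_term_le A f j k) hs

/-- The product of a function with coefficients in the weighted `ℓ¹` space and a function of
`H¹` is in `H¹`, in a dual form. -/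
theorem sum_mul_wt_conv_le {A f : ℤ → ℂ} (hA : MemW1 A) (hf : MemH1 f) {c : ℤ → ℝ}
    (hc : ∀ k, 0 ≤ c k) (I : Finset ℤ) :
    ∑ k ∈ I, c k * (wt k * ‖conv A f k‖)
      ≤ (∑' k, wt k * ‖A k‖) / 2 * (∑ k ∈ I, c k ^ 2 + ∑' k, (wt k * ‖f k‖) ^ 2) :=
  (Finset.sum_le_sum fun k _ => mul_le_mul_of_nonneg_left (wt_mul_norm_conv_le hA hf k) (hc k)).trans
    (sum_mul_tsum_le (wt_mul_norm_nonneg A) (wt_mul_norm_nonneg f) hA hf I)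

theorem MemW1.of_support {A : ℤ → ℂ} {I : Finset ℤ} (h : ∀ k ∉ I, A k = 0) : MemW1 A :=
  summable_of_ne_finset_zero (s := I) fun k hk => by simp [h k hk]

theorem MemH1.of_support {A : ℤ → ℂ} {I : Finset ℤ} (h : ∀ k ∉ I, A k = 0) : MemH1 A :=
  summable_of_ne_finset_zero (s := I) fun k hk => by simp [h k hk]

theorem MemH1.sub {f g : ℤ → ℂ} (hf : MemH1 f) (hg : MemH1 g) : MemH1 (fun k => f k - g k) := by
  refine Summable.of_nonneg_of_le (fun k => sq_nonneg _) (fun k => ?_)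
    ((hf.add hg).mul_left 2)
  have h : wt k * ‖f k - g k‖ ≤ wt k * ‖f k‖ + wt k * ‖g k‖ := by
    rw [← mul_add]
    exact mul_le_mul_of_nonneg_left (norm_sub_le _ _) (wt_nonneg k)
  have h' := pow_le_pow_left₀ (mul_nonneg (wt_nonneg k) (norm_nonneg _)) h 2
  nlinarith [sq_nonneg (wt k * ‖f k‖ - wt k * ‖g k‖)]

theorem conv_sub_right {A f g : ℤ → ℂ} (hA : MemW1 A) (hf : MemH1 f) (hg : MemH1 g) (k : ℤ) :
    conv A (fun k => f k - g k) k = conv A f k - conv A g k := by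
  unfold conv
  rw [← (summable_conv hA hf k).tsum_sub (summable_conv hA hg k)]
  exact tsum_congr fun j => mul_sub _ _ _

theorem conv_eq_sum {f : ℤ → ℂ} {I : Finset ℤ} (h : ∀ k ∉ I, f k = 0) (g : ℤ → ℂ) (k : ℤ) :
    conv f g k = ∑ j ∈ I, f j * g (k - j) :=
  tsum_eq_sum fun j hj => by rw [h j hj, zero_mul]

/-- The transport term is antisymmetric up to a term without derivatives of `θ`. -/
theorem abs_re_transport_le {θ w : ℤ → ℂ} {I : Finset ℤ} (hθ : ∀ k ∉ I, θ k = 0) (hw : MemW1 w)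
    (hreal : ∀ k, w (-k) = conj (w k)) :
    |(∑ k ∈ I, conj (θ k) * (2 * Real.pi * Complex.I * k * conv θ w k)).re|
      ≤ Real.pi * (∑' k, wt k * ‖w k‖) * ∑ k ∈ I, ‖θ k‖ ^ 2 := by
  set S := ∑ k ∈ I, conj (θ k) * (2 * Real.pi * Complex.I * k * conv θ w k) with hS
  have e1 : S = ∑ k ∈ I, ∑ j ∈ I,
      2 * Real.pi * Complex.I * (k : ℂ) * (conj (θ k) * θ j * w (k - j)) := by
    refine Finset.sum_congr rfl fun k _ => ?_
    rw [conv_eq_sum hθ, Finset.mul_sum, Finset.mul_sum]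
    exact Finset.sum_congr rfl fun j _ => by ring
  -- Conjugation and the exchange of `j` and `k` reproduce the same products, because `w` is real;
  -- only the factor `k` becomes `-j`.
  have e2 : conj S = ∑ k ∈ I, ∑ j ∈ I,
      -(2 * Real.pi * Complex.I * (j : ℂ)) * (conj (θ k) * θ j * w (k - j)) := by
    rw [e1, map_sum, Finset.sum_congr rfl fun k _ => map_sum _ _ _, Finset.sum_comm]
    refine Finset.sum_congr rfl fun k _ => Finset.sum_congr rfl fun j _ => ?_
    have h : conj (w (j - k)) = w (k - j) := by rw [← hreal, neg_sub]
    have h2 : conj (2 : ℂ) = 2 := Complex.conj_ofNat 2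
    simp only [map_mul, h, h2, Complex.conj_conj, Complex.conj_I, Complex.conj_ofReal, map_intCast]
    ring
  -- In `S + conj S` the factor is `k - j`, the argument of `w`: the derivative has moved from `θ`
  -- to `w`.
  have e3 : ((2 * S.re : ℝ) : ℂ) = ∑ k ∈ I, ∑ j ∈ I,
      2 * Real.pi * Complex.I * ((k - j : ℤ) : ℂ) * (conj (θ k) * θ j * w (k - j)) := by
    rw [← Complex.add_conj, e2, e1, ← Finset.sum_add_distrib]
    refine Finset.sum_congr rfl fun k _ => ?_
    rw [← Finset.sum_add_distrib]
    refine Finset.sum_congr rfl fun j _ => ?_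
    push_cast
    ring
  have hK : Summable fun k => wt k * ‖w k‖ := hw
  set K := ∑' k, wt k * ‖w k‖ with hKdef
  have e4 : |2 * S.re| ≤ ∑ k ∈ I, ∑ j ∈ I,
      Real.pi * (‖θ k‖ ^ 2 + ‖θ j‖ ^ 2) * (wt (k - j) * ‖w (k - j)‖) := by
    rw [← Real.norm_eq_abs, ← Complex.norm_real, e3]
    refine (norm_sum_le _ _).trans (Finset.sum_le_sum fun k _ => ?_)
    refine (norm_sum_le _ _).trans (Finset.sum_le_sum fun j _ => ?_)
    simp only [norm_mul, Complex.norm_ofNat, Complex.norm_real, Complex.norm_I, RCLike.norm_conj,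
      Complex.norm_intCast, Real.norm_eq_abs, abs_of_pos Real.pi_pos]
    have h1 : |((k - j : ℤ) : ℝ)| * ‖w (k - j)‖ ≤ wt (k - j) * ‖w (k - j)‖ :=
      mul_le_mul_of_nonneg_right (abs_le_wt _) (norm_nonneg _)
    have h2 : 2 * (‖θ k‖ * ‖θ j‖) ≤ ‖θ k‖ ^ 2 + ‖θ j‖ ^ 2 := by
      nlinarith [sq_nonneg (‖θ k‖ - ‖θ j‖)]
    have h3 := mul_le_mul h2 h1 (by positivity) (by positivity)
    have h4 := mul_le_mul_of_nonneg_left h3 Real.pi_pos.le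
    linarith
  -- Schur's test: the row sums and the column sums of the kernel `wt (k - j) ‖w (k - j)‖` are both
  -- at most `K`.
  have e5 : ∑ k ∈ I, ∑ j ∈ I, Real.pi * (‖θ k‖ ^ 2 + ‖θ j‖ ^ 2) * (wt (k - j) * ‖w (k - j)‖)
      ≤ 2 * (Real.pi * K * ∑ k ∈ I, ‖θ k‖ ^ 2) := by
    have s1 : ∑ k ∈ I, ∑ j ∈ I, Real.pi * ‖θ k‖ ^ 2 * (wt (k - j) * ‖w (k - j)‖)
        ≤ Real.pi * K * ∑ k ∈ I, ‖θ k‖ ^ 2 := by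
      rw [Finset.mul_sum]
      refine Finset.sum_le_sum fun k _ => ?_
      rw [← Finset.mul_sum]
      have := mul_le_mul_of_nonneg_left
        (sum_comp_sub_left_le_tsum (wt_mul_norm_nonneg w) hK I k)
        (by positivity : 0 ≤ Real.pi * ‖θ k‖ ^ 2)
      linarith
    have s2 : ∑ k ∈ I, ∑ j ∈ I, Real.pi * ‖θ j‖ ^ 2 * (wt (k - j) * ‖w (k - j)‖)
        ≤ Real.pi * K * ∑ k ∈ I, ‖θ k‖ ^ 2 := by
      rw [Finset.sum_comm, Finset.mul_sum]
      refine Finset.sum_le_sum fun k _ => ?_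
      rw [← Finset.mul_sum]
      have := mul_le_mul_of_nonneg_left
        (sum_comp_sub_right_le_tsum (wt_mul_norm_nonneg w) hK I k)
        (by positivity : 0 ≤ Real.pi * ‖θ k‖ ^ 2)
      linarith
    simp only [mul_add, add_mul, Finset.sum_add_distrib]
    linarith
  rw [abs_mul, abs_two] at e4
  linarith

/-! ### The system in Fourier variables and its energy estimate -/

/-- The right-hand side of the first equation in Fourier variables, with linear symbol `α`. -/
def fieldFst (α : ℤ → ℝ) (l : ℝ) (z w : ℤ → ℂ) (k : ℤ) : ℂ :=
  -(2 * Real.pi * Complex.I * k) * (α k * w k + l * conv z w k)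

/-- The right-hand side of the second equation in Fourier variables, with linear symbol `β`,
divided by the symbol `D`. -/
def fieldSnd (β D : ℤ → ℝ) (l : ℝ) (z w : ℤ → ℂ) (k : ℤ) : ℂ :=
  -(2 * Real.pi * Complex.I * k) / D k * (β k * z k + l / 2 * conv w w k)

/-- The rate of change of the energy carried by the `k`-th mode. -/
def energyRate (α β D : ℤ → ℝ) (l : ℝ) (Z U z w : ℤ → ℂ) (k : ℤ) : ℝ :=
  2 * (conj (Z k - z k) * (fieldFst α l Z U k - fieldFst α l z w k)).re +
    α k * D k / β k *
      (2 * (conj (U k - w k) * (fieldSnd β D l Z U k - fieldSnd β D l z w k)).re)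

/-- In the rate of the energy, the linear terms cancel. -/
theorem energyRate_eq {α β D : ℤ → ℝ} {l : ℝ} {Z U z w : ℤ → ℂ} {k : ℤ} (hβ : β k ≠ 0)
    (hD : D k ≠ 0) {p q : ℂ} (hp : conv Z U k - conv z w k = p)
    (hq : conv U U k - conv w w k = q) :
    energyRate α β D l Z U z w k
      = -(2 * l) * (conj (Z k - z k) * (2 * Real.pi * Complex.I * k * p)).re
        - l * (α k / β k) * (conj (U k - w k) * (2 * Real.pi * Complex.I * k * q)).re := by
  have hβ' : (β k : ℂ) ≠ 0 := by exact_mod_cast hβ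
  have hD' : (D k : ℂ) ≠ 0 := by exact_mod_cast hD
  set θ := Z k - z k with hθ
  set ξ := U k - w k with hξ
  have e1 : fieldFst α l Z U k - fieldFst α l z w k
      = -(2 * Real.pi * Complex.I * k) * (α k * ξ + l * p) := by
    rw [← hp, hξ, fieldFst, fieldFst]; ring
  have e2 : fieldSnd β D l Z U k - fieldSnd β D l z w k
      = -(2 * Real.pi * Complex.I * k) / D k * (β k * θ + l / 2 * q) := by
    rw [← hq, hθ, fieldSnd, fieldSnd]; ring
  -- The weight `α D / β` cancels the division by `D` and turns the linear coefficient `β` of `θ`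
  -- into `α`, the coefficient of `ξ` in the first equation.
  have e3 : α k * D k / β k * (2 * (conj ξ * (fieldSnd β D l Z U k - fieldSnd β D l z w k)).re)
      = 2 * (conj ξ * (-(2 * Real.pi * Complex.I * k) *
          (α k * θ + ((l / 2 * (α k / β k) : ℝ) : ℂ) * q))).re := by
    have : ((α k * D k / β k : ℝ) : ℂ) *
        (conj ξ * (fieldSnd β D l Z U k - fieldSnd β D l z w k))
        = conj ξ * (-(2 * Real.pi * Complex.I * k) *
          (α k * θ + ((l / 2 * (α k / β k) : ℝ) : ℂ) * q)) := by
      rw [e2]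
      push_cast
      field_simp
    rw [← this, Complex.re_ofReal_mul]
    ring
  have e4 : (2 * Real.pi * Complex.I * k : ℂ) = ((2 * Real.pi * k : ℝ) : ℂ) * Complex.I := by
    push_cast; ring
  rw [energyRate, e3, e1, e4]
  -- With `2πik = s i` and `s` real, the linear terms are the real part of `-i s α (conj θ ξ + conj
  -- ξ θ)`. The bracket is real, so they vanish.
  generalize (2 * Real.pi * k : ℝ) = s
  simp only [Complex.mul_re, Complex.mul_im, Complex.add_re, Complex.add_im, Complex.neg_re,
    Complex.neg_im, Complex.ofReal_re, Complex.ofReal_im, Complex.I_re, Complex.I_im,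
    Complex.conj_re, Complex.conj_im]
  ring

theorem neg_mul_re_le (l : ℝ) (x p : ℂ) (k : ℤ) :
    -l * (conj x * (2 * Real.pi * Complex.I * k * p)).re
      ≤ 2 * Real.pi * |l| * (‖x‖ * (wt k * ‖p‖)) := by
  refine (le_abs_self _).trans ?_
  rw [abs_mul, abs_neg]
  have h := Complex.abs_re_le_norm (conj x * (2 * Real.pi * Complex.I * k * p))
  simp only [norm_mul, Complex.norm_ofNat, Complex.norm_real, Complex.norm_I, RCLike.norm_conj,
    Complex.norm_intCast, Real.norm_eq_abs, abs_of_pos Real.pi_pos] at h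
  have h1 : |(k : ℝ)| * ‖p‖ ≤ wt k * ‖p‖ := mul_le_mul_of_nonneg_right (abs_le_wt k) (norm_nonneg _)
  have h2 := mul_le_mul_of_nonneg_left h1
    (by positivity : 0 ≤ |l| * (2 * Real.pi * ‖x‖))
  have h3 := mul_le_mul_of_nonneg_left h (abs_nonneg l)
  linarith

/-- The part of a sequence outside a finite set. -/
def tailPart (I : Finset ℤ) (Z : ℤ → ℂ) (k : ℤ) : ℂ := if k ∈ I then 0 else Z k

theorem norm_tailPart_le (I : Finset ℤ) (Z : ℤ → ℂ) (k : ℤ) : ‖tailPart I Z k‖ ≤ ‖Z k‖ := by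
  unfold tailPart
  split_ifs <;> simp

theorem MemH1.tailPart {Z : ℤ → ℂ} (h : MemH1 Z) (I : Finset ℤ) : MemH1 (tailPart I Z) :=
  Summable.of_nonneg_of_le (fun _ => sq_nonneg _) (fun k => pow_le_pow_left₀
    (wt_mul_norm_nonneg _ k)
    (mul_le_mul_of_nonneg_left (norm_tailPart_le I Z k) (wt_nonneg k)) 2) h

/-- The differential inequality for the energy, conditional on a common bound `L` for the weighted
`ℓ¹` norms of `Z`, `U` and `w`. No such norm of `z` is needed: `z` is eliminated in favour of `θ`
and the tail of `Z`. -/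
theorem sum_energyRate_le {α β D : ℤ → ℝ} {l L ρ : ℝ} {Z U z w : ℤ → ℂ} {I : Finset ℤ}
    (hα : ∀ k, 0 < α k) (hβ : ∀ k, 0 < β k) (hD : ∀ k, 0 < D k) (hρ : ∀ k, α k / β k ≤ ρ)
    (hZ1 : MemW1 Z) (hU1 : MemW1 U) (hZ : MemH1 Z) (hU : MemH1 U)
    (hz : ∀ k ∉ I, z k = 0) (hw : ∀ k ∉ I, w k = 0) (hreal : ∀ k, w (-k) = conj (w k))
    (hZL : ∑' k, wt k * ‖Z k‖ ≤ L) (hUL : ∑' k, wt k * ‖U k‖ ≤ L)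
    (hwL : ∑' k, wt k * ‖w k‖ ≤ L) :
    ∑ k ∈ I, energyRate α β D l Z U z w k
      ≤ 2 * Real.pi * |l| * L * (3 + 2 * ρ) * (∑ k ∈ I, ‖Z k - z k‖ ^ 2 +
        ∑' k, (wt k * ‖U k - w k‖) ^ 2 + ∑' k, (wt k * ‖tailPart I Z k‖) ^ 2) := by
  set f : ℤ → ℂ := fun k => U k - w k with hf
  set q : ℤ → ℂ := BoussinesqSpectral.tailPart I Z with hq
  set θ : ℤ → ℂ := fun k => if k ∈ I then Z k - z k else 0 with hθ
  have hw1 : MemW1 w := MemW1.of_support hw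
  have hwH : MemH1 w := MemH1.of_support hw
  have hz1 : MemW1 z := MemW1.of_support hz
  have hzH : MemH1 z := MemH1.of_support hz
  have hfH : MemH1 f := hU.sub hwH
  have hqH : MemH1 q := hZ.tailPart I
  have hθ0 : ∀ k ∉ I, θ k = 0 := fun k hk => if_neg hk
  have hθH : MemH1 θ := MemH1.of_support hθ0
  have hρ0 : 0 ≤ ρ := (div_nonneg (hα 0).le (hβ 0).le).trans (hρ 0)
  have hL0 : 0 ≤ L := (tsum_nonneg (wt_mul_norm_nonneg w)).trans hwL
  have hqθ : q = fun k => (fun k => Z k - z k) k - θ k := by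
    funext k
    by_cases hk : k ∈ I
    · simp [hq, hθ, BoussinesqSpectral.tailPart, hk]
    · simp [hq, hθ, BoussinesqSpectral.tailPart, hk, hz k hk]
  -- `ZU - zw = Z (U - w) + (Z - z) w`, with `Z - z = θ + q`. In each product one factor is a
  -- coefficient sequence with bounded weighted `ℓ¹` norm; of the others, `f` and `q` are taken in
  -- `H¹`, and `θ` only in `L²`.
  have hp : ∀ k, conv Z U k - conv z w k = conv Z f k + conv w q k + conv θ w k := fun k => by
    rw [hqθ, conv_sub_right hw1 (hZ.sub hzH) hθH, conv_sub_right hw1 hZ hzH, hf,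
      conv_sub_right hZ1 hU hwH, conv_comm θ w, conv_comm z w, conv_comm Z w]
    ring
  have hq2 : ∀ k, conv U U k - conv w w k = conv U f k + conv w f k := fun k => by
    rw [hf, conv_sub_right hU1 hU hwH, conv_sub_right hw1 hU hwH, conv_comm U w]
    ring
  have key : ∀ k ∈ I, energyRate α β D l Z U z w k
      ≤ 4 * Real.pi * |l| * (‖θ k‖ * (wt k * ‖conv Z f k‖))
        + 4 * Real.pi * |l| * (‖θ k‖ * (wt k * ‖conv w q k‖))
        - 2 * l * (conj (θ k) * (2 * Real.pi * Complex.I * k * conv θ w k)).re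
        + 2 * Real.pi * |l| * ρ * (‖f k‖ * (wt k * ‖conv U f k‖))
        + 2 * Real.pi * |l| * ρ * (‖f k‖ * (wt k * ‖conv w f k‖)) := fun k hk => by
    rw [energyRate_eq (hβ k).ne' (hD k).ne' (hp k) (hq2 k)]
    have e : Z k - z k = θ k := by simp [hθ, hk]
    change _ - l * (α k / β k) * (conj (f k) * _).re ≤ _
    rw [e]
    have h1 := neg_mul_re_le (2 * l) (θ k) (conv Z f k) k
    have h2 := neg_mul_re_le (2 * l) (θ k) (conv w q k) k
    have hr0 : 0 ≤ α k / β k := div_nonneg (hα k).le (hβ k).le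
    have hw0 := wt_nonneg k
    have h3 := mul_le_mul_of_nonneg_left (neg_mul_re_le l (f k) (conv U f k) k) hr0
    have h4 := mul_le_mul_of_nonneg_left (neg_mul_re_le l (f k) (conv w f k) k) hr0
    have h5 := mul_le_mul_of_nonneg_right (hρ k)
      (by positivity : 0 ≤ 2 * Real.pi * |l| * (‖f k‖ * (wt k * ‖conv U f k‖)))
    have h6 := mul_le_mul_of_nonneg_right (hρ k)
      (by positivity : 0 ≤ 2 * Real.pi * |l| * (‖f k‖ * (wt k * ‖conv w f k‖)))
    rw [abs_mul, abs_two] at h1 h2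
    simp only [mul_add, Complex.add_re]
    linarith
  have s1 := sum_mul_wt_conv_le hZ1 hfH (fun k => norm_nonneg (θ k)) I
  have s2 := sum_mul_wt_conv_le hw1 hqH (fun k => norm_nonneg (θ k)) I
  have s3 := abs_re_transport_le hθ0 hw1 hreal
  have s4 := sum_mul_wt_conv_le hU1 hfH (fun k => norm_nonneg (f k)) I
  have s5 := sum_mul_wt_conv_le hw1 hfH (fun k => norm_nonneg (f k)) I
  have hX : ∑ k ∈ I, ‖Z k - z k‖ ^ 2 = ∑ k ∈ I, ‖θ k‖ ^ 2 :=
    Finset.sum_congr rfl fun k hk => by simp [hθ, hk]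
  have hF : ∑ k ∈ I, ‖f k‖ ^ 2 ≤ ∑' k, (wt k * ‖f k‖) ^ 2 := by
    refine le_trans (Finset.sum_le_sum fun k _ => ?_)
      (Summable.sum_le_tsum I (fun k _ => sq_nonneg (wt k * ‖f k‖)) hfH)
    exact pow_le_pow_left₀ (norm_nonneg _)
      (le_mul_of_one_le_left (norm_nonneg _) (one_le_wt k)) 2
  rw [hX]
  change _ ≤ 2 * Real.pi * |l| * L * (3 + 2 * ρ) *
    (∑ k ∈ I, ‖θ k‖ ^ 2 + ∑' k, (wt k * ‖f k‖) ^ 2 + ∑' k, (wt k * ‖q k‖) ^ 2)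
  have hX0 : 0 ≤ ∑ k ∈ I, ‖θ k‖ ^ 2 := Finset.sum_nonneg fun k _ => sq_nonneg _
  have hQ0 : 0 ≤ ∑' k, (wt k * ‖q k‖) ^ 2 := tsum_nonneg fun k => sq_nonneg _
  have hF0 : 0 ≤ ∑' k, (wt k * ‖f k‖) ^ 2 := tsum_nonneg fun k => sq_nonneg _
  have hFI0 : 0 ≤ ∑ k ∈ I, ‖f k‖ ^ 2 := Finset.sum_nonneg fun k _ => sq_nonneg _
  generalize ∑ k ∈ I, ‖θ k‖ ^ 2 = X at *
  generalize ∑' k, (wt k * ‖q k‖) ^ 2 = Q at *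
  generalize ∑' k, (wt k * ‖f k‖) ^ 2 = F at *
  generalize ∑ k ∈ I, ‖f k‖ ^ 2 = FI at *
  refine (Finset.sum_le_sum key).trans ?_
  simp only [Finset.sum_add_distrib, Finset.sum_sub_distrib, ← Finset.mul_sum]
  rw [← Complex.re_sum]
  have t1 : ∀ {K S : ℝ}, K ≤ L → 0 ≤ S → K / 2 * S ≤ L / 2 * S := fun h1 h2 =>
    mul_le_mul_of_nonneg_right (by linarith) h2
  replace s1 := s1.trans (t1 hZL (by linarith))
  replace s2 := s2.trans (t1 hwL (by linarith))
  replace s4 := s4.trans (t1 hUL (by linarith))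
  replace s5 := s5.trans (t1 hwL (by linarith))
  have s3' : -(2 * l) * (∑ k ∈ I, conj (θ k) * (2 * Real.pi * Complex.I * k * conv θ w k)).re
      ≤ 2 * |l| * (Real.pi * L * X) := by
    refine (le_abs_self _).trans ?_
    rw [abs_mul, abs_neg, abs_mul, abs_two]
    refine mul_le_mul_of_nonneg_left (s3.trans ?_) (by positivity)
    exact mul_le_mul_of_nonneg_right (mul_le_mul_of_nonneg_left hwL Real.pi_pos.le) hX0
  have p0 : 0 ≤ Real.pi * |l| := by positivity
  have p1 := mul_le_mul_of_nonneg_left s1 p0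
  have p2 := mul_le_mul_of_nonneg_left s2 p0
  have p4 := mul_le_mul_of_nonneg_left s4 (mul_nonneg p0 hρ0)
  have p5 := mul_le_mul_of_nonneg_left s5 (mul_nonneg p0 hρ0)
  have p6 := mul_le_mul_of_nonneg_left hF (mul_nonneg (mul_nonneg p0 hρ0) hL0)
  have n1 := mul_nonneg (mul_nonneg p0 hL0) hX0
  have n2 := mul_nonneg (mul_nonneg p0 hL0) hF0
  have n3 := mul_nonneg (mul_nonneg p0 hL0) hQ0
  have n4 := mul_nonneg hρ0 n1
  have n5 := mul_nonneg hρ0 n3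
  -- The `3` counts the occurrences of `X`, one from each of the three parts of `ZU - zw`; the `2 *
  -- ρ` comes from the two parts of `UU - ww`, after bounding `FI` by `F`.
  nlinarith only [p1, p2, p4, p5, p6, n1, n2, n3, n4, n5, s3']

/-! ### Trigonometric polynomials -/

theorem mem_modes {N : ℕ} {k : ℤ} : k ∈ modes N ↔ |k| ≤ (N : ℤ) := by
  rw [Finset.mem_Icc, abs_le]

theorem neg_mem_modes {N : ℕ} {k : ℤ} : -k ∈ modes N ↔ k ∈ modes N := by
  rw [mem_modes, mem_modes, abs_neg]

/-- `v` is the real trigonometric polynomial of degree at most `N` with coefficients `z`. -/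
def IsTrigPoly (N : ℕ) (v : ℝ → ℝ) (z : ℤ → ℂ) : Prop :=
  ∀ x, (v x : ℂ) = ∑ j ∈ modes N, z j * expMode j x

theorem expMode_mem_trigSpace {N : ℕ} {k : ℤ} (hk : k ∈ modes N) : expMode k ∈ trigSpace N :=
  Submodule.subset_span ⟨k, mem_modes.mp hk, rfl⟩

theorem mem_trigSpace_iff {N : ℕ} {f : ℝ → ℂ} :
    f ∈ trigSpace N ↔ ∃ c : ℤ → ℂ, f = fun x => ∑ j ∈ modes N, c j * expMode j x := by
  constructor
  · intro hf
    induction hf using Submodule.span_induction with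
    | mem f hf =>
      obtain ⟨k, hk, rfl⟩ := hf
      refine ⟨fun j => if j = k then 1 else 0, funext fun x => ?_⟩
      simp only [ite_mul, one_mul, zero_mul, Finset.sum_ite_eq']
      rw [if_pos (mem_modes.mpr hk)]
    | zero => exact ⟨0, funext fun x => by simp⟩
    | add f g _ _ hf hg =>
      obtain ⟨c, rfl⟩ := hf
      obtain ⟨d, rfl⟩ := hg
      exact ⟨c + d, funext fun x => by simp [add_mul, Finset.sum_add_distrib]⟩
    | smul r f _ hf =>
      obtain ⟨c, rfl⟩ := hf
      exact ⟨fun j => r * c j, funext fun x => by simp [Finset.mul_sum, mul_assoc]⟩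
  · rintro ⟨c, rfl⟩
    have : (fun x => ∑ j ∈ modes N, c j * expMode j x) = ∑ j ∈ modes N, c j • expMode j := by
      funext x
      simp
    rw [this]
    exact Submodule.sum_mem _ fun j hj => Submodule.smul_mem _ _ (expMode_mem_trigSpace hj)

namespace IsTrigPoly

variable {N : ℕ} {v : ℝ → ℝ} {z : ℤ → ℂ}

theorem fourierHat_eq (h : IsTrigPoly N v z) (k : ℤ) :
    fourierHat v k = if k ∈ modes N then z k else 0 := fourierHat_of_eq_sum h k

theorem fourierHat_eq_zero (h : IsTrigPoly N v z) {k : ℤ} (hk : k ∉ modes N) :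
    fourierHat v k = 0 := by rw [h.fourierHat_eq, if_neg hk]

theorem fourierHat_of_mem (h : IsTrigPoly N v z) {k : ℤ} (hk : k ∈ modes N) :
    fourierHat v k = z k := by rw [h.fourierHat_eq, if_pos hk]

theorem self (h : IsTrigPoly N v z) : IsTrigPoly N v (fourierHat v) := fun x => by
  rw [h x]
  exact Finset.sum_congr rfl fun j hj => by rw [h.fourierHat_of_mem hj]

theorem contDiff (h : IsTrigPoly N v z) : ContDiff ℝ ∞ v := by
  have e : v = fun x => (∑ j ∈ modes N, z j * expMode j x).re :=
    funext fun x => by rw [← h x, Complex.ofReal_re]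
  rw [e]
  exact Complex.reCLM.contDiff.comp
    (ContDiff.sum fun j _ => contDiff_const.mul (contDiff_expMode j))

theorem periodic (h : IsTrigPoly N v z) : Function.Periodic v 1 := fun x => by
  rw [← Complex.ofReal_inj, h, h]
  exact Finset.sum_congr rfl fun j _ => by rw [periodic_expMode j x]

theorem mem_trigSpace (h : IsTrigPoly N v z) : (fun x => (v x : ℂ)) ∈ trigSpace N :=
  mem_trigSpace_iff.mpr ⟨z, funext h⟩

end IsTrigPoly

theorem isTrigPoly_of_mem {N : ℕ} {v : ℝ → ℝ} (h : (fun x => (v x : ℂ)) ∈ trigSpace N) :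
    IsTrigPoly N v (fourierHat v) := by
  obtain ⟨c, hc⟩ := mem_trigSpace_iff.mp h
  exact IsTrigPoly.self (z := c) (congrFun hc)

theorem isTrigPoly_trigProj (N : ℕ) (v : ℝ → ℝ) : IsTrigPoly N (trigProj N v) (fourierHat v) :=
  ofReal_trigProj N v

/-- A sum over the modes with symmetric coefficients is real. -/
theorem isTrigPoly_re {N : ℕ} {z : ℤ → ℂ} (hz : ∀ k, z (-k) = conj (z k)) :
    IsTrigPoly N (fun x => (∑ j ∈ modes N, z j * expMode j x).re) z := by
  intro x
  apply Complex.conj_eq_iff_re.mp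
  rw [map_sum]
  refine Finset.sum_nbij' (fun k => -k) (fun k => -k) ?_ ?_ ?_ ?_ ?_
  · intro k hk; exact neg_mem_modes.mpr hk
  · intro k hk; exact neg_mem_modes.mpr hk
  · intro k _; simp
  · intro k _; simp
  · intro k _
    rw [map_mul, hz, conj_expMode]

theorem memLp_of_continuous {f : ℝ → ℝ} (hf : Continuous f) :
    MemLp f 2 (volume.restrict (Ioc (0 : ℝ) 1)) := by
  obtain ⟨C, hC⟩ := isCompact_Icc.exists_bound_of_continuousOn (s := Icc (0 : ℝ) 1) hf.continuousOn
  refine MemLp.of_bound hf.aestronglyMeasurable C ?_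
  filter_upwards [ae_restrict_mem measurableSet_Ioc] with x hx
  exact hC x ⟨hx.1.le, hx.2⟩

theorem pairing_sum_right {f : ℝ → ℝ} (hf : IntervalIntegrable f volume 0 1) (I : Finset ℤ)
    (c : ℤ → ℂ) :
    pairing f (fun x => ∑ j ∈ I, c j * expMode j x) = ∑ j ∈ I, conj (c j) * fourierHat f j := by
  unfold fourierHat pairing
  simp only [← intervalIntegral.integral_const_mul]
  rw [← intervalIntegral.integral_finsetSum (f := fun j x => conj (c j) *
    ((f x : ℂ) * conj (expMode j x))) fun j _ =>
      (IntervalIntegrable.pairing hf (continuous_expMode j)).const_mul _]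
  refine intervalIntegral.integral_congr fun x _ => ?_
  simp only [map_sum, map_mul, Finset.mul_sum]
  exact Finset.sum_congr rfl fun j _ => by ring

/-- The coefficients of a trigonometric polynomial from its values at equidistant points. -/
theorem dft_expMode {n : ℕ} (hn : 0 < n) {m : ℤ} (hm : |m| < n) :
    ∑ j ∈ Finset.range n, expMode m (j / n) = if m = 0 then (n : ℂ) else 0 := by
  have hn' : (n : ℂ) ≠ 0 := by exact_mod_cast hn.ne'
  have e : ∀ j : ℕ, expMode m (j / n) = Complex.exp (2 * Real.pi * Complex.I * m / n) ^ j := by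
    intro j
    rw [← Complex.exp_nat_mul, expMode]
    congr 1
    push_cast
    ring
  simp only [e]
  split_ifs with h
  · simp [h]
  · have h1 : Complex.exp (2 * Real.pi * Complex.I * m / n) ≠ 1 := by
      rw [Ne, Complex.exp_eq_one_iff]
      rintro ⟨l, hl⟩
      have hpi : (2 * Real.pi * Complex.I : ℂ) ≠ 0 := Complex.two_pi_I_ne_zero
      have h2 : (m : ℂ) = l * n := by
        field_simp at hl
        have := mul_left_cancel₀ hpi (by linear_combination (2 * Real.pi * Complex.I) * hl :
          (2 * Real.pi * Complex.I : ℂ) * m = 2 * Real.pi * Complex.I * (l * n))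
        exact this
      have h3 : m = l * n := by exact_mod_cast h2
      rw [h3, abs_mul, Nat.abs_cast] at hm
      have h4 : |l| < 1 := by
        by_contra hc
        push Not at hc
        nlinarith [(by exact_mod_cast hn : (0 : ℤ) < n)]
      have h5 : l = 0 := Int.abs_lt_one_iff.mp h4
      exact h (by rw [h3, h5, zero_mul])
    have h2 : Complex.exp (2 * Real.pi * Complex.I * m / n) ^ n = 1 := by
      rw [← Complex.exp_nat_mul, Complex.exp_eq_one_iff]
      exact ⟨m, by field_simp⟩
    have h3 := mul_geom_sum (Complex.exp (2 * Real.pi * Complex.I * m / n)) n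
    rw [h2, sub_self] at h3
    exact (mul_eq_zero.mp h3).resolve_left (sub_ne_zero.mpr h1)

/-- The coefficients are finite combinations of point values, so differentiability in time at each
fixed `x` passes to them without differentiation under an integral. Differences of two modes are at
most `2N` in absolute value, hence `2N + 1` points suffice. -/
theorem IsTrigPoly.dft {N : ℕ} {v : ℝ → ℝ} {z : ℤ → ℂ} (h : IsTrigPoly N v z) {k : ℤ}
    (hk : k ∈ modes N) :
    z k = ((2 * N + 1 : ℕ) : ℂ)⁻¹ * ∑ j ∈ Finset.range (2 * N + 1),
      (v (j / (2 * N + 1 : ℕ)) : ℂ) * expMode (-k) (j / (2 * N + 1 : ℕ)) := by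
  have e : ∀ x : ℝ, (v x : ℂ) * expMode (-k) x = ∑ i ∈ modes N, z i * expMode (i - k) x := by
    intro x
    rw [h x, Finset.sum_mul]
    exact Finset.sum_congr rfl fun i _ => by rw [sub_eq_add_neg, expMode_add, mul_assoc]
  simp only [e]
  rw [Finset.sum_comm, Finset.sum_congr rfl fun i hi => (Finset.mul_sum _ _ _).symm]
  have hd : ∀ i ∈ modes N, ∑ j ∈ Finset.range (2 * N + 1),
      expMode (i - k) ((j : ℝ) / (2 * N + 1 : ℕ)) = if i = k then ((2 * N + 1 : ℕ) : ℂ) else 0 := by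
    intro i hi
    rw [dft_expMode (Nat.succ_pos _)]
    · simp only [sub_eq_zero]
    · rw [mem_modes, abs_le] at hi hk
      rw [abs_lt]
      push_cast
      omega
  rw [Finset.sum_congr rfl fun i hi => by rw [hd i hi]]
  simp only [mul_ite, mul_zero, Finset.sum_ite_eq', if_pos hk]
  rw [mul_comm, mul_assoc, mul_inv_cancel₀ (Nat.cast_ne_zero.mpr (Nat.succ_ne_zero _)), mul_one]

/-! ### The equations in Fourier variables -/

/-- The symbol `κ₁ - a (2πk)²`. -/
def symFst (γ δ a : ℝ) (k : ℤ) : ℝ := kappa₁ γ δ - a * (2 * Real.pi * k) ^ 2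

/-- The symbol `κ₂ - c' (2πk)²`. -/
def symSnd (γ c : ℝ) (k : ℤ) : ℝ := kappa₂ γ - cPrime γ c * (2 * Real.pi * k) ^ 2

/-- The symbol `1 + d (2πk)²` of `1 - d ∂ₓ²`. -/
def symD (d : ℝ) (k : ℤ) : ℝ := 1 + d * (2 * Real.pi * k) ^ 2

theorem symD_pos {d : ℝ} (hd : 0 < d) (k : ℤ) : 0 < symD d k := by
  unfold symD; positivity

theorem conv_fourierHat {f g : ℝ → ℝ} (hf : MemLp f 2 (volume.restrict (Ioc (0 : ℝ) 1)))
    (hg : MemLp g 2 (volume.restrict (Ioc (0 : ℝ) 1))) (k : ℤ) :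
    conv (fourierHat f) (fourierHat g) k = fourierHat (fun x => f x * g x) k :=
  (hasSum_fourierHat_mul hf hg k).tsum_eq

theorem fourierHat_smul (r : ℝ) (f : ℝ → ℝ) (k : ℤ) :
    fourierHat (fun x => r * f x) k = r * fourierHat f k := pairing_smul_left r f _

theorem pairing_const_mul_right (c : ℂ) (f : ℝ → ℝ) (φ : ℝ → ℂ) :
    pairing f (fun x => c * φ x) = conj c * pairing f φ := pairing_smul_right c f φ

/-- The residual of the first Galerkin equation. -/
theorem galerkin_fst_eq {γ δ a : ℝ} {v u vt : ℝ → ℝ} (hv : ContDiff ℝ ∞ v)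
    (hvp : Function.Periodic v 1) (hu : ContDiff ℝ ∞ u) (hup : Function.Periodic u 1) (k : ℤ) :
    fourierHat vt k + kappa₁ γ δ * fourierHat (deriv u) k
      + lam γ δ * fourierHat (deriv fun x => v x * u x) k
      + a * fourierHat (iteratedDeriv 3 u) k
      = fourierHat vt k
        - fieldFst (symFst γ δ a) (lam γ δ) (fourierHat v) (fourierHat u) k := by
  rw [fourierHat_deriv (hu.of_le (by exact_mod_cast le_top)) hup,
    fourierHat_deriv ((hv.mul hu).of_le (by exact_mod_cast le_top)) (hvp.mul hup),
    fourierHat_iteratedDeriv hu hup, fieldFst,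
    conv_fourierHat (memLp_of_continuous hv.continuous) (memLp_of_continuous hu.continuous)]
  have hI : Complex.I ^ 3 = -Complex.I := Complex.I_pow_three
  simp only [symFst, mul_pow, hI]
  push_cast
  ring

/-- The residual of the second Galerkin equation. -/
theorem galerkin_snd_eq {γ δ c d : ℝ} (hd : 0 < d) {v u ut : ℝ → ℝ} (hv : ContDiff ℝ ∞ v)
    (hvp : Function.Periodic v 1) (hu : ContDiff ℝ ∞ u) (hup : Function.Periodic u 1)
    (hut : ContDiff ℝ ∞ ut) (hutp : Function.Periodic ut 1) (k : ℤ) :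
    fourierHat ut k + kappa₂ γ * fourierHat (deriv v) k
      + lam γ δ * fourierHat (fun x => u x * deriv u x) k
      + cPrime γ c * fourierHat (iteratedDeriv 3 v) k - d * fourierHat (iteratedDeriv 2 ut) k
      = symD d k * (fourierHat ut k
        - fieldSnd (symSnd γ c) (symD d) (lam γ δ) (fourierHat v) (fourierHat u) k) := by
  have hD : (symD d k : ℂ) ≠ 0 := by exact_mod_cast (symD_pos hd k).ne'
  -- The conservative form `u u_x = (u²)_x / 2` produces the factor `l / 2` in `fieldSnd`.
  have e : (fun x => u x * deriv u x) = fun x => (1 / 2 : ℝ) * deriv (fun x => u x * u x) x := by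
    funext x
    have h := ((hu.differentiable (by simp)) x).hasDerivAt
    rw [(h.fun_mul h).deriv]
    ring
  rw [e, fourierHat_smul, fourierHat_deriv (hv.of_le (by exact_mod_cast le_top)) hvp,
    fourierHat_deriv ((hu.mul hu).of_le (by exact_mod_cast le_top)) (hup.mul hup),
    fourierHat_iteratedDeriv hv hvp, fourierHat_iteratedDeriv hut hutp, fieldSnd,
    ← conv_fourierHat (memLp_of_continuous hu.continuous) (memLp_of_continuous hu.continuous)]
  have hI : Complex.I ^ 3 = -Complex.I := Complex.I_pow_three
  have e2 : (symD d k : ℂ) * (fourierHat ut k - -(2 * Real.pi * Complex.I * k) / symD d k *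
      (symSnd γ c k * fourierHat v k + lam γ δ / 2 * conv (fourierHat u) (fourierHat u) k))
      = symD d k * fourierHat ut k + 2 * Real.pi * Complex.I * k *
      (symSnd γ c k * fourierHat v k + lam γ δ / 2 * conv (fourierHat u) (fourierHat u) k) := by
    field_simp
    ring
  rw [e2]
  simp only [symSnd, symD, mul_pow, hI, Complex.I_sq]
  push_cast
  ring

theorem IsSolution.fourierHat_fst {γ δ a b c d T : ℝ} {ζ₀ u₀ : ℝ → ℝ} {ζ u ζt ut : ℝ → ℝ → ℝ}
    (h : IsSolution γ δ a b c d T ζ₀ u₀ ζ u ζt ut) (hb : b = 0) {t : ℝ} (ht : t ∈ Icc 0 T)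
    (hζ : MemLp (ζ t) 2 (volume.restrict (Ioc (0 : ℝ) 1)))
    (hu : MemLp (u t) 2 (volume.restrict (Ioc (0 : ℝ) 1))) (k : ℤ) :
    fourierHat (ζt t) k
      = fieldFst (symFst γ δ a) (lam γ δ) (fourierHat (ζ t)) (fourierHat (u t)) k := by
  have e := h.eq_fst t ht (expMode k) (contDiff_expMode k) (periodic_expMode k)
  simp only [deriv_expMode, iteratedDeriv_expMode, pairing_const_mul_right, hb] at e
  have e1 : ∀ f, pairing f (expMode k) = fourierHat f k := fun _ => rfl
  have h2 : conj (2 : ℂ) = 2 := Complex.conj_ofNat 2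
  simp only [e1, map_mul, map_pow, h2, Complex.conj_I, Complex.conj_ofReal, map_intCast, mul_pow,
    Complex.I_pow_three, map_neg, neg_neg] at e
  rw [fieldFst, conv_fourierHat hζ hu, symFst]
  push_cast
  push_cast at e
  linear_combination e

theorem IsSolution.fourierHat_snd {γ δ a b c d T : ℝ} {ζ₀ u₀ : ℝ → ℝ} {ζ u ζt ut : ℝ → ℝ → ℝ}
    (h : IsSolution γ δ a b c d T ζ₀ u₀ ζ u ζt ut) (hd : 0 < d) {t : ℝ} (ht : t ∈ Icc 0 T)
    (hu : MemLp (u t) 2 (volume.restrict (Ioc (0 : ℝ) 1))) (k : ℤ) :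
    fourierHat (ut t) k
      = fieldSnd (symSnd γ c) (symD d) (lam γ δ) (fourierHat (ζ t)) (fourierHat (u t)) k := by
  have hD : (symD d k : ℂ) ≠ 0 := by exact_mod_cast (symD_pos hd k).ne'
  have e := h.eq_snd t ht (expMode k) (contDiff_expMode k) (periodic_expMode k)
  have e0 : (fun x => u t x ^ 2 / 2) = fun x => (1 / 2 : ℝ) * (u t x * u t x) :=
    funext fun x => by ring
  simp only [deriv_expMode, iteratedDeriv_expMode, pairing_const_mul_right, e0,
    pairing_smul_left] at e
  have e1 : ∀ f, pairing f (expMode k) = fourierHat f k := fun _ => rfl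
  have h2 : conj (2 : ℂ) = 2 := Complex.conj_ofNat 2
  simp only [e1, map_mul, map_pow, h2, Complex.conj_I, Complex.conj_ofReal, map_intCast, mul_pow,
    Complex.I_pow_three, Complex.I_sq, map_neg, map_one, neg_neg] at e
  rw [fieldSnd, conv_fourierHat hu hu, div_mul_eq_mul_div, eq_div_iff hD, symD, symSnd]
  push_cast
  push_cast at e
  linear_combination e

/-! ### The semidiscrete problem as a system of ordinary differential equations -/

/-- The Galerkin equations for the Fourier coefficients. -/
structure IsCoeffSolution (α β D : ℤ → ℝ) (l T : ℝ) (N : ℕ) (Z₀ U₀ : ℤ → ℂ)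
    (z w : ℝ → ℤ → ℂ) : Prop where
  supp_fst : ∀ t ∈ Icc 0 T, ∀ k ∉ modes N, z t k = 0
  supp_snd : ∀ t ∈ Icc 0 T, ∀ k ∉ modes N, w t k = 0
  real_fst : ∀ t ∈ Icc 0 T, ∀ k, z t (-k) = conj (z t k)
  real_snd : ∀ t ∈ Icc 0 T, ∀ k, w t (-k) = conj (w t k)
  deriv_fst : ∀ t ∈ Icc 0 T, ∀ k ∈ modes N,
    HasDerivWithinAt (fun s => z s k) (fieldFst α l (z t) (w t) k) (Icc 0 T) t
  deriv_snd : ∀ t ∈ Icc 0 T, ∀ k ∈ modes N,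
    HasDerivWithinAt (fun s => w s k) (fieldSnd β D l (z t) (w t) k) (Icc 0 T) t
  init_fst : ∀ k ∈ modes N, z 0 k = Z₀ k
  init_snd : ∀ k ∈ modes N, w 0 k = U₀ k

section Coefficients

variable {T : ℝ} {N : ℕ} {v : ℝ → ℝ → ℝ}

theorem hasDerivWithinAt_of_coeff {z : ℝ → ℤ → ℂ} {z' : ℤ → ℂ}
    (hv : ∀ t ∈ Icc 0 T, IsTrigPoly N (v t) (z t)) {t : ℝ} (ht : t ∈ Icc 0 T)
    (hz : ∀ k ∈ modes N, HasDerivWithinAt (fun s => z s k) (z' k) (Icc 0 T) t) (x : ℝ) :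
    HasDerivWithinAt (fun s => (v s x : ℂ)) (∑ j ∈ modes N, z' j * expMode j x) (Icc 0 T) t := by
  have h : HasDerivWithinAt (fun s => ∑ j ∈ modes N, z s j * expMode j x)
      (∑ j ∈ modes N, z' j * expMode j x) (Icc 0 T) t :=
    HasDerivWithinAt.fun_sum fun j hj => (hz j hj).mul_const _
  exact h.congr (fun s hs => hv s hs x) (hv t ht x)

theorem differentiableOn_of_coeff {z : ℝ → ℤ → ℂ} {z' : ℝ → ℤ → ℂ}
    (hv : ∀ t ∈ Icc 0 T, IsTrigPoly N (v t) (z t))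
    (hz : ∀ t ∈ Icc 0 T, ∀ k ∈ modes N,
      HasDerivWithinAt (fun s => z s k) (z' t k) (Icc 0 T) t) (x : ℝ) :
    DifferentiableOn ℝ (fun t => v t x) (Icc 0 T) := fun t ht => by
  have h := Complex.reCLM.hasFDerivAt.comp_hasDerivWithinAt t
    (hasDerivWithinAt_of_coeff hv ht (hz t ht) x)
  exact h.differentiableWithinAt

theorem isTrigPoly_timeDeriv (hT : 0 < T) {z : ℝ → ℤ → ℂ} {z' : ℤ → ℂ}
    (hv : ∀ t ∈ Icc 0 T, IsTrigPoly N (v t) (z t)) {t : ℝ} (ht : t ∈ Icc 0 T)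
    (hd : ∀ x, DifferentiableOn ℝ (fun t => v t x) (Icc 0 T))
    (hz : ∀ k ∈ modes N, HasDerivWithinAt (fun s => z s k) (z' k) (Icc 0 T) t) :
    IsTrigPoly N (timeDeriv T v t) z' := fun x => by
  have h1 := hasDerivWithinAt_of_coeff hv ht hz x
  have h2 : HasDerivWithinAt (fun s => v s x) (timeDeriv T v t x) (Icc 0 T) t :=
    (hd x t ht).hasDerivWithinAt
  have h3 := Complex.ofRealCLM.hasFDerivAt.comp_hasDerivWithinAt t h2
  exact (uniqueDiffOn_Icc hT t ht).eq_deriv _ h3 h1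

theorem differentiableWithinAt_fourierHat (hv : ∀ t ∈ Icc 0 T, IsTrigPoly N (v t) (fourierHat (v t)))
    (hd : ∀ x, DifferentiableOn ℝ (fun t => v t x) (Icc 0 T)) {t : ℝ} (ht : t ∈ Icc 0 T)
    {k : ℤ} (hk : k ∈ modes N) :
    DifferentiableWithinAt ℝ (fun s => fourierHat (v s) k) (Icc 0 T) t := by
  refine DifferentiableWithinAt.congr (f := fun s => ((2 * N + 1 : ℕ) : ℂ)⁻¹ *
    ∑ j ∈ Finset.range (2 * N + 1),
      (v s (j / (2 * N + 1 : ℕ)) : ℂ) * expMode (-k) (j / (2 * N + 1 : ℕ))) ?_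
    (fun s hs => (hv s hs).dft hk) ((hv t ht).dft hk)
  refine DifferentiableWithinAt.const_mul (DifferentiableWithinAt.fun_sum fun j _ => ?_) _
  refine DifferentiableWithinAt.mul_const ?_ _
  exact Complex.ofRealCLM.differentiableAt.comp_differentiableWithinAt t (hd _ t ht)

/-- Testing with single exponentials turns the weak formulation into ordinary differential equations
for the coefficients; in the second one the positive symbol `D` is divided out. -/
theorem IsGalerkinSolution.coeff {γ δ a b c d : ℝ} {ζ₀ u₀ : ℝ → ℝ} {ζN uN : ℝ → ℝ → ℝ}
    (hT : 0 < T) (hb : b = 0) (hd : 0 < d)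
    (h : IsGalerkinSolution γ δ a b c d T ζ₀ u₀ N ζN uN) :
    IsCoeffSolution (symFst γ δ a) (symSnd γ c) (symD d) (lam γ δ) T N (fourierHat ζ₀)
      (fourierHat u₀) (fun t => fourierHat (ζN t)) (fun t => fourierHat (uN t)) := by
  have h1 : ∀ t ∈ Icc 0 T, IsTrigPoly N (ζN t) (fourierHat (ζN t)) := fun t ht =>
    isTrigPoly_of_mem (h.mem_fst t ht)
  have h2 : ∀ t ∈ Icc 0 T, IsTrigPoly N (uN t) (fourierHat (uN t)) := fun t ht =>
    isTrigPoly_of_mem (h.mem_snd t ht)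
  have d1 : ∀ t ∈ Icc 0 T, ∀ k ∈ modes N, HasDerivWithinAt (fun s => fourierHat (ζN s) k)
      (derivWithin (fun s => fourierHat (ζN s) k) (Icc 0 T) t) (Icc 0 T) t := fun t ht k hk =>
    (differentiableWithinAt_fourierHat h1 h.diff_fst ht hk).hasDerivWithinAt
  have d2 : ∀ t ∈ Icc 0 T, ∀ k ∈ modes N, HasDerivWithinAt (fun s => fourierHat (uN s) k)
      (derivWithin (fun s => fourierHat (uN s) k) (Icc 0 T) t) (Icc 0 T) t := fun t ht k hk =>
    (differentiableWithinAt_fourierHat h2 h.diff_snd ht hk).hasDerivWithinAt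
  refine ⟨fun t ht k hk => (h1 t ht).fourierHat_eq_zero hk,
    fun t ht k hk => (h2 t ht).fourierHat_eq_zero hk,
    fun t _ k => (conj_fourierHat _ k).symm, fun t _ k => (conj_fourierHat _ k).symm,
    fun t ht k hk => ?_, fun t ht k hk => ?_, fun k hk => ?_, fun k hk => ?_⟩
  · have p1 := isTrigPoly_timeDeriv hT h1 ht h.diff_fst (d1 t ht)
    have e := h.eq_fst t ht (expMode k) (expMode_mem_trigSpace hk)
    rw [hb, Complex.ofReal_zero, zero_mul, sub_zero] at e
    have e' := (galerkin_fst_eq (γ := γ) (δ := δ) (a := a) (vt := timeDeriv T ζN t)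
      (h1 t ht).contDiff (h1 t ht).periodic (h2 t ht).contDiff (h2 t ht).periodic k).symm.trans e
    rw [p1.fourierHat_of_mem hk, sub_eq_zero] at e'
    rw [← e']
    exact d1 t ht k hk
  · have p2 := isTrigPoly_timeDeriv hT h2 ht h.diff_snd (d2 t ht)
    have e := h.eq_snd t ht (expMode k) (expMode_mem_trigSpace hk)
    have e' := (galerkin_snd_eq (γ := γ) (δ := δ) (c := c) hd
      (h1 t ht).contDiff (h1 t ht).periodic (h2 t ht).contDiff (h2 t ht).periodic
      p2.contDiff p2.periodic k).symm.trans e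
    have hD : (symD d k : ℂ) ≠ 0 := by exact_mod_cast (symD_pos hd k).ne'
    rw [p2.fourierHat_of_mem hk, mul_eq_zero, sub_eq_zero] at e'
    rw [← e'.resolve_left hD]
    exact d2 t ht k hk
  · simp only [h.init_fst]
    exact (isTrigPoly_trigProj N ζ₀).fourierHat_of_mem hk
  · simp only [h.init_snd]
    exact (isTrigPoly_trigProj N u₀).fourierHat_of_mem hk

theorem intervalIntegrable_of_contDiff {f : ℝ → ℝ} (hf : ContDiff ℝ ∞ f) :
    IntervalIntegrable f volume 0 1 := hf.continuous.intervalIntegrable _ _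

theorem contDiff_iteratedDeriv {f : ℝ → ℝ} (hf : ContDiff ℝ ∞ f) (n : ℕ) :
    ContDiff ℝ ∞ (iteratedDeriv n f) := by
  rw [iteratedDeriv_eq_iterate]
  exact ContDiff.iterate_deriv n hf

theorem contDiff_deriv {f : ℝ → ℝ} (hf : ContDiff ℝ ∞ f) : ContDiff ℝ ∞ (deriv f) := by
  simpa using contDiff_iteratedDeriv hf 1

theorem IsCoeffSolution.galerkin {γ δ a b c d : ℝ} {ζ₀ u₀ : ℝ → ℝ} {z w : ℝ → ℤ → ℂ}
    (hT : 0 < T) (hb : b = 0) (hd : 0 < d)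
    (h : IsCoeffSolution (symFst γ δ a) (symSnd γ c) (symD d) (lam γ δ) T N (fourierHat ζ₀)
      (fourierHat u₀) z w) :
    IsGalerkinSolution γ δ a b c d T ζ₀ u₀ N
      (fun t x => (∑ j ∈ modes N, z t j * expMode j x).re)
      (fun t x => (∑ j ∈ modes N, w t j * expMode j x).re) := by
  set ζN : ℝ → ℝ → ℝ := fun t x => (∑ j ∈ modes N, z t j * expMode j x).re with hζN
  set uN : ℝ → ℝ → ℝ := fun t x => (∑ j ∈ modes N, w t j * expMode j x).re with huN
  have h1 : ∀ t ∈ Icc 0 T, IsTrigPoly N (ζN t) (z t) := fun t ht => isTrigPoly_re (h.real_fst t ht)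
  have h2 : ∀ t ∈ Icc 0 T, IsTrigPoly N (uN t) (w t) := fun t ht => isTrigPoly_re (h.real_snd t ht)
  have f1 := differentiableOn_of_coeff h1 h.deriv_fst
  have f2 := differentiableOn_of_coeff h2 h.deriv_snd
  have e1 : ∀ t ∈ Icc 0 T, fourierHat (ζN t) = z t := fun t ht => funext fun k => by
    rw [(h1 t ht).fourierHat_eq]
    split_ifs with hk
    · rfl
    · exact (h.supp_fst t ht k hk).symm
  have e2 : ∀ t ∈ Icc 0 T, fourierHat (uN t) = w t := fun t ht => funext fun k => by
    rw [(h2 t ht).fourierHat_eq]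
    split_ifs with hk
    · rfl
    · exact (h.supp_snd t ht k hk).symm
  refine ⟨fun t ht => (h1 t ht).mem_trigSpace, fun t ht => (h2 t ht).mem_trigSpace, f1, f2,
    fun t ht φ hφ => ?_, fun t ht φ hφ => ?_, ?_, ?_⟩
  · obtain ⟨q, rfl⟩ := mem_trigSpace_iff.mp hφ
    have p1 := isTrigPoly_timeDeriv hT h1 ht f1 (h.deriv_fst t ht)
    have c1 := (h1 t ht).contDiff
    have c2 := (h2 t ht).contDiff
    rw [hb, Complex.ofReal_zero, zero_mul, sub_zero,
      pairing_sum_right (intervalIntegrable_of_contDiff p1.contDiff),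
      pairing_sum_right (intervalIntegrable_of_contDiff (contDiff_deriv c2)),
      pairing_sum_right (intervalIntegrable_of_contDiff (contDiff_deriv (c1.mul c2))),
      pairing_sum_right (intervalIntegrable_of_contDiff (contDiff_iteratedDeriv c2 3))]
    simp only [Finset.mul_sum, ← Finset.sum_add_distrib]
    refine Finset.sum_eq_zero fun k hk => ?_
    have e := galerkin_fst_eq (γ := γ) (δ := δ) (a := a) (vt := timeDeriv T ζN t)
      c1 (h1 t ht).periodic c2 (h2 t ht).periodic k
    rw [p1.fourierHat_of_mem hk, e1 t ht, e2 t ht, sub_self] at e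
    rw [p1.fourierHat_of_mem hk]
    linear_combination conj (q k) * e
  · obtain ⟨q, rfl⟩ := mem_trigSpace_iff.mp hφ
    have p2 := isTrigPoly_timeDeriv hT h2 ht f2 (h.deriv_snd t ht)
    have c1 := (h1 t ht).contDiff
    have c2 := (h2 t ht).contDiff
    rw [pairing_sum_right (intervalIntegrable_of_contDiff p2.contDiff),
      pairing_sum_right (intervalIntegrable_of_contDiff (contDiff_deriv c1)),
      pairing_sum_right (intervalIntegrable_of_contDiff (c2.mul (contDiff_deriv c2))),
      pairing_sum_right (intervalIntegrable_of_contDiff (contDiff_iteratedDeriv c1 3)),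
      pairing_sum_right (intervalIntegrable_of_contDiff (contDiff_iteratedDeriv p2.contDiff 2))]
    simp only [Finset.mul_sum, ← Finset.sum_add_distrib, ← Finset.sum_sub_distrib]
    refine Finset.sum_eq_zero fun k hk => ?_
    have e := galerkin_snd_eq (γ := γ) (δ := δ) (c := c) hd
      c1 (h1 t ht).periodic c2 (h2 t ht).periodic p2.contDiff p2.periodic k
    rw [p2.fourierHat_of_mem hk, e1 t ht, e2 t ht, sub_self, mul_zero] at e
    rw [p2.fourierHat_of_mem hk]
    linear_combination conj (q k) * e
  · funext x
    simp only [hζN, trigProj]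
    rw [Finset.sum_congr rfl fun k hk => by rw [h.init_fst k hk]]
  · funext x
    simp only [huN, trigProj]
    rw [Finset.sum_congr rfl fun k hk => by rw [h.init_snd k hk]]

end Coefficients

/-! ### Sobolev norms -/

/-- The weight `(1 + k²)^μ` of `H^μ`. -/
def sobWt (μ : ℝ) (k : ℤ) : ℝ := (1 + (k : ℝ) ^ 2) ^ μ

theorem sobWt_pos (μ : ℝ) (k : ℤ) : 0 < sobWt μ k := Real.rpow_pos_of_pos (by positivity) μ

theorem sobWt_nonneg (μ : ℝ) (k : ℤ) : 0 ≤ sobWt μ k := (sobWt_pos μ k).le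

theorem one_le_sobWt {μ : ℝ} (hμ : 0 ≤ μ) (k : ℤ) : 1 ≤ sobWt μ k :=
  Real.one_le_rpow (by nlinarith [sq_nonneg (k : ℝ)]) hμ

theorem sobWt_one (k : ℤ) : sobWt 1 k = 1 + (k : ℝ) ^ 2 := Real.rpow_one _

theorem sobWt_zero (k : ℤ) : sobWt 0 k = 1 := Real.rpow_zero _

theorem sobWt_le_of_le {σ μ : ℝ} (h : σ ≤ μ) (k : ℤ) : sobWt σ k ≤ sobWt μ k :=
  Real.rpow_le_rpow_of_exponent_le (by nlinarith [sq_nonneg (k : ℝ)]) h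

theorem sobWt_term_nonneg (μ : ℝ) (A : ℤ → ℂ) (k : ℤ) : 0 ≤ sobWt μ k * ‖A k‖ ^ 2 :=
  mul_nonneg (sobWt_nonneg μ k) (sq_nonneg _)

/-- The square of the norm of `H^μ` in terms of the Fourier coefficients. -/
def sobSq (μ : ℝ) (A : ℤ → ℂ) : ℝ := ∑' k, sobWt μ k * ‖A k‖ ^ 2

theorem sobSq_nonneg (μ : ℝ) (A : ℤ → ℂ) : 0 ≤ sobSq μ A := tsum_nonneg (sobWt_term_nonneg μ A)

/-- The sequences of Fourier coefficients of elements of `H^μ`. -/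
def SobSummable (μ : ℝ) (A : ℤ → ℂ) : Prop := Summable fun k => sobWt μ k * ‖A k‖ ^ 2

theorem sobolevNorm_eq (μ : ℝ) (v : ℝ → ℝ) :
    sobolevNorm μ v = Real.sqrt (sobSq μ (fourierHat v)) := rfl

theorem sobolevNorm_nonneg (μ : ℝ) (v : ℝ → ℝ) : 0 ≤ sobolevNorm μ v := Real.sqrt_nonneg _

theorem sobolevNorm_sq (μ : ℝ) (v : ℝ → ℝ) : sobolevNorm μ v ^ 2 = sobSq μ (fourierHat v) :=
  Real.sq_sqrt (sobSq_nonneg _ _)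

theorem sobWt_term_add_le (μ : ℝ) (A B : ℤ → ℂ) (k : ℤ) : sobWt μ k * ‖A k + B k‖ ^ 2
    ≤ 2 * (sobWt μ k * ‖A k‖ ^ 2) + 2 * (sobWt μ k * ‖B k‖ ^ 2) := by
  have h := pow_le_pow_left₀ (norm_nonneg _) (norm_add_le (A k) (B k)) 2
  have h2 : ‖A k + B k‖ ^ 2 ≤ 2 * ‖A k‖ ^ 2 + 2 * ‖B k‖ ^ 2 := by
    nlinarith [sq_nonneg (‖A k‖ - ‖B k‖)]
  have := mul_le_mul_of_nonneg_left h2 (sobWt_nonneg μ k)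
  linarith

namespace SobSummable

variable {μ : ℝ} {A B : ℤ → ℂ}

theorem add (hA : SobSummable μ A) (hB : SobSummable μ B) :
    SobSummable μ (fun k => A k + B k) :=
  Summable.of_nonneg_of_le (sobWt_term_nonneg μ _) (sobWt_term_add_le μ A B)
    ((hA.mul_left 2).add (hB.mul_left 2))

theorem sobSq_add_le (hA : SobSummable μ A) (hB : SobSummable μ B) :
    sobSq μ (fun k => A k + B k) ≤ 2 * sobSq μ A + 2 * sobSq μ B := by
  unfold sobSq
  rw [← tsum_mul_left, ← tsum_mul_left, ← (hA.mul_left 2).tsum_add (hB.mul_left 2)]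
  exact (hA.add hB).tsum_le_tsum (sobWt_term_add_le μ A B) ((hA.mul_left 2).add (hB.mul_left 2))

theorem const_mul (hA : SobSummable μ A) (c : ℂ) : SobSummable μ (fun k => c * A k) := by
  refine (Summable.mul_left (‖c‖ ^ 2) hA).congr fun k => ?_
  rw [norm_mul]
  ring

theorem norm_sq_le (hμ : 0 ≤ μ) (hA : SobSummable μ A) (k : ℤ) : ‖A k‖ ^ 2 ≤ sobSq μ A :=
  (le_mul_of_one_le_left (sq_nonneg _) (one_le_sobWt hμ k)).trans
    (Summable.le_tsum hA k fun j _ => sobWt_term_nonneg μ A j)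

theorem mono {σ : ℝ} (h : σ ≤ μ) (hA : SobSummable μ A) : SobSummable σ A :=
  Summable.of_nonneg_of_le (sobWt_term_nonneg σ A)
    (fun k => mul_le_mul_of_nonneg_right (sobWt_le_of_le h k) (sq_nonneg _)) hA

end SobSummable

theorem sobSq_const_mul (μ : ℝ) (c : ℂ) (A : ℤ → ℂ) :
    sobSq μ (fun k => c * A k) = ‖c‖ ^ 2 * sobSq μ A := by
  unfold sobSq
  rw [← tsum_mul_left]
  refine tsum_congr fun k => ?_
  rw [norm_mul]
  ring

theorem wt_sq_le (k : ℤ) : wt k ^ 2 ≤ 2 * sobWt 1 k := by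
  rw [sobWt_one, wt, ← sq_abs (k : ℝ)]
  nlinarith [sq_nonneg (1 - |(k : ℝ)|)]

theorem sobWt_one_le (k : ℤ) : sobWt 1 k ≤ wt k ^ 2 := by
  rw [sobWt_one, wt, ← sq_abs (k : ℝ)]
  nlinarith [abs_nonneg (k : ℝ)]

theorem SobSummable.memH1 {μ : ℝ} {A : ℤ → ℂ} (hμ : 1 ≤ μ) (hA : SobSummable μ A) : MemH1 A := by
  refine Summable.of_nonneg_of_le (fun k => sq_nonneg _) (fun k => ?_)
    ((hA.mono hμ).mul_left 2)
  rw [mul_pow]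
  have := mul_le_mul_of_nonneg_right (wt_sq_le k) (sq_nonneg ‖A k‖)
  linarith

/-- The terms decay like `|k|^{2-2μ}`, and `2μ - 2 > 1`. This convergence is what the embedding of
`H^μ` into the weighted `ℓ¹` space rests on. -/
theorem summable_wt_sq_mul {μ : ℝ} (hμ : 3 / 2 < μ) :
    Summable fun k : ℤ => wt k ^ 2 * sobWt (-μ) k := by
  have h : Summable fun k : ℤ => 2 * |(k : ℝ)| ^ (-(2 * μ - 2)) :=
    (Real.summable_abs_int_rpow (by linarith)).mul_left 2
  refine Summable.of_norm_bounded_eventually h ?_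
  have : ∀ᶠ k : ℤ in cofinite, k ≠ 0 := by
    rw [eventually_cofinite]
    simp
  filter_upwards [this] with k hk
  have hk' : 0 < |(k : ℝ)| := abs_pos.mpr (by exact_mod_cast hk)
  rw [Real.norm_of_nonneg (mul_nonneg (sq_nonneg _) (sobWt_nonneg _ _))]
  refine (mul_le_mul_of_nonneg_right (wt_sq_le k) (sobWt_nonneg _ _)).trans ?_
  rw [mul_assoc]
  refine mul_le_mul_of_nonneg_left ?_ zero_le_two
  unfold sobWt
  rw [← Real.rpow_add (by positivity)]
  have e : |(k : ℝ)| ^ (-(2 * μ - 2)) = ((k : ℝ) ^ 2) ^ (1 + -μ) := by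
    rw [← sq_abs, ← Real.rpow_natCast, ← Real.rpow_mul (abs_nonneg _)]
    congr 1
    push_cast
    ring
  rw [e]
  exact Real.rpow_le_rpow_of_nonpos (by positivity) (by linarith) (by linarith)

/-- The inequality `2xy ≤ x² + y²` with `x = wt k (1 + k²)^{-μ/2}` and `y = (1 + k²)^{μ/2} ‖A k‖`.
-/
theorem wt_mul_norm_le_half_add {μ : ℝ} (A : ℤ → ℂ) (k : ℤ) :
    wt k * ‖A k‖ ≤ (wt k ^ 2 * sobWt (-μ) k + sobWt μ k * ‖A k‖ ^ 2) / 2 := by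
  have h1 : sobWt (-μ) k * sobWt μ k = 1 := by
    unfold sobWt
    rw [← Real.rpow_add (by positivity), neg_add_cancel, Real.rpow_zero]
  have h2 := sobWt_pos μ k
  have h3 := mul_nonneg (sobWt_nonneg (-μ) k) (sq_nonneg (wt k - sobWt μ k * ‖A k‖))
  have h4 : sobWt (-μ) k * (wt k - sobWt μ k * ‖A k‖) ^ 2
      = wt k ^ 2 * sobWt (-μ) k - 2 * (sobWt (-μ) k * sobWt μ k) * (wt k * ‖A k‖)
        + (sobWt (-μ) k * sobWt μ k) * (sobWt μ k * ‖A k‖ ^ 2) := by ring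
  rw [h4, h1] at h3
  linarith

theorem SobSummable.memW1 {μ : ℝ} {A : ℤ → ℂ} (hμ : 3 / 2 < μ) (hA : SobSummable μ A) :
    MemW1 A :=
  Summable.of_nonneg_of_le (wt_mul_norm_nonneg A) (wt_mul_norm_le_half_add A)
    (((summable_wt_sq_mul hμ).add hA).div_const 2)

theorem SobSummable.tsum_wt_le {μ : ℝ} {A : ℤ → ℂ} (hμ : 3 / 2 < μ) (hA : SobSummable μ A) :
    ∑' k, wt k * ‖A k‖ ≤ (∑' k, wt k ^ 2 * sobWt (-μ) k + sobSq μ A) / 2 := by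
  have hs := (summable_wt_sq_mul hμ).add hA
  rw [sobSq, ← (summable_wt_sq_mul hμ).tsum_add hA, ← tsum_div_const]
  exact (hA.memW1 hμ).tsum_le_tsum (wt_mul_norm_le_half_add A) (hs.div_const 2)

theorem SobSummable.tailPart {μ : ℝ} {A : ℤ → ℂ} (hA : SobSummable μ A) (I : Finset ℤ) :
    SobSummable μ (tailPart I A) :=
  Summable.of_nonneg_of_le (sobWt_term_nonneg μ _) (fun k => mul_le_mul_of_nonneg_left
    (pow_le_pow_left₀ (norm_nonneg _) (norm_tailPart_le I A k) 2) (sobWt_nonneg μ k)) hA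

/-- The error of the truncation of the Fourier series. -/
theorem SobSummable.sobSq_tailPart_le {σ μ : ℝ} {A : ℤ → ℂ} (h : σ ≤ μ) (hA : SobSummable μ A)
    {N : ℕ} (hN : 1 ≤ N) :
    sobSq σ (BoussinesqSpectral.tailPart (modes N) A) ≤ ((N : ℝ) ^ (σ - μ)) ^ 2 * sobSq μ A := by
  unfold sobSq
  rw [← tsum_mul_left]
  refine Summable.tsum_le_tsum (fun k => ?_) ((hA.mono h).tailPart _) (hA.mul_left _)
  unfold BoussinesqSpectral.tailPart
  split_ifs with hk
  · rw [norm_zero, zero_pow two_ne_zero, mul_zero]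
    exact mul_nonneg (sq_nonneg _) (sobWt_term_nonneg μ A k)
  · rw [← mul_assoc]
    refine mul_le_mul_of_nonneg_right ?_ (sq_nonneg _)
    rw [mem_modes, not_le] at hk
    have hk' : (N : ℝ) < |(k : ℝ)| := by exact_mod_cast hk
    have hN' : (1 : ℝ) ≤ N := by exact_mod_cast hN
    -- The excess weight has exponent `σ - μ ≤ 0`, so it is largest at the smallest frequency;
    -- outside the modes `1 + k² ≥ N²`.
    have e1 : sobWt σ k = sobWt (σ - μ) k * sobWt μ k := by
      unfold sobWt
      rw [← Real.rpow_add (by positivity)]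
      congr 1
      ring
    have e2 : ((N : ℝ) ^ (σ - μ)) ^ 2 = ((N : ℝ) ^ 2) ^ (σ - μ) := by
      rw [← Real.rpow_natCast, ← Real.rpow_natCast, ← Real.rpow_mul (by positivity),
        ← Real.rpow_mul (by positivity), mul_comm]
    rw [e1, e2]
    refine mul_le_mul_of_nonneg_right ?_ (sobWt_nonneg _ _)
    refine Real.rpow_le_rpow_of_nonpos (by positivity) ?_ (by linarith)
    rw [← sq_abs (k : ℝ)]
    nlinarith

theorem SobSummable.tsum_wt_tailPart_le {μ : ℝ} {A : ℤ → ℂ} (h : 1 ≤ μ) (hA : SobSummable μ A)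
    {N : ℕ} (hN : 1 ≤ N) :
    ∑' k, (wt k * ‖BoussinesqSpectral.tailPart (modes N) A k‖) ^ 2
      ≤ 2 * (((N : ℝ) ^ (1 - μ)) ^ 2 * sobSq μ A) := by
  refine le_trans ?_ (mul_le_mul_of_nonneg_left (hA.sobSq_tailPart_le h hN) zero_le_two)
  unfold sobSq
  rw [← tsum_mul_left]
  refine Summable.tsum_le_tsum (fun k => ?_) ((hA.memH1 h).tailPart _)
    (((hA.mono h).tailPart _).mul_left 2)
  rw [mul_pow, ← mul_assoc]
  exact mul_le_mul_of_nonneg_right (wt_sq_le k) (sq_nonneg _)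

theorem l2Norm_sq (v : ℝ → ℝ) (hv : MemLp v 2 (volume.restrict (Ioc (0 : ℝ) 1))) :
    l2Norm v ^ 2 = sobSq 0 (fourierHat v) := by
  have h := hasSum_norm_fourierHat_sq hv
  rw [l2Norm, Real.sq_sqrt, ← h.tsum_eq, sobSq]
  · simp only [sobWt_zero, one_mul]
  · exact intervalIntegral.integral_nonneg zero_le_one fun x _ => sq_nonneg _

theorem fourierHat_sub {f g : ℝ → ℝ} (hf : MemLp f 2 (volume.restrict (Ioc (0 : ℝ) 1)))
    (hg : MemLp g 2 (volume.restrict (Ioc (0 : ℝ) 1))) (k : ℤ) :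
    fourierHat (fun x => f x - g x) k = fourierHat f k - fourierHat g k :=
  pairing_sub_left (intervalIntegrable_of_memLp hf) (intervalIntegrable_of_memLp hg)
    (continuous_expMode k)

theorem IsTrigPoly.memLp {N : ℕ} {v : ℝ → ℝ} {z : ℤ → ℂ} (h : IsTrigPoly N v z) :
    MemLp v 2 (volume.restrict (Ioc (0 : ℝ) 1)) := memLp_of_continuous h.contDiff.continuous

theorem MemSobolev.sobSummable {μ : ℝ} {v : ℝ → ℝ} (h : MemSobolev μ v) :
    SobSummable μ (fourierHat v) := h.summable

theorem fourierHat_sub_trigProj {v : ℝ → ℝ} (hv : MemLp v 2 (volume.restrict (Ioc (0 : ℝ) 1)))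
    (N : ℕ) :
    fourierHat (fun x => v x - trigProj N v x) = tailPart (modes N) (fourierHat v) := by
  funext k
  rw [fourierHat_sub hv (isTrigPoly_trigProj N v).memLp, (isTrigPoly_trigProj N v).fourierHat_eq,
    tailPart]
  split_ifs <;> simp

/-- The error of the projection onto trigonometric polynomials. -/
theorem projection_error {μ : ℝ} (hμ : 1 ≤ μ) {v : ℝ → ℝ} (hv : MemSobolev μ v) {N : ℕ}
    (hN : 1 ≤ N) :
    sobolevNorm 1 (fun x => v x - trigProj N v x) ≤ (N : ℝ) ^ (1 - μ) * sobolevNorm μ v ∧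
      l2Norm (fun x => v x - trigProj N v x) ≤ (N : ℝ) ^ (-μ) * sobolevNorm μ v := by
  have e := fourierHat_sub_trigProj hv.memLp N
  constructor
  · refine le_of_sq_le_sq ?_ (by have := sobolevNorm_nonneg μ v; positivity)
    rw [sobolevNorm_sq, mul_pow, sobolevNorm_sq, e]
    exact hv.sobSummable.sobSq_tailPart_le hμ hN
  · refine le_of_sq_le_sq ?_ (by have := sobolevNorm_nonneg μ v; positivity)
    have hm : MemLp (fun x => v x - trigProj N v x) 2 (volume.restrict (Ioc (0 : ℝ) 1)) :=
      hv.memLp.sub (isTrigPoly_trigProj N v).memLp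
    rw [l2Norm_sq _ hm, mul_pow,
      sobolevNorm_sq, e,
      ← zero_sub μ]
    exact hv.sobSummable.sobSq_tailPart_le (by linarith) hN

/-! ### Continuously differentiable functions with values in `H^μ` -/

section C1

variable {T μ : ℝ} {g g' : ℝ → ℝ → ℝ}

theorem fourierHat_quotient (h : IsC1Sobolev T μ g g') {s t : ℝ} (hs : s ∈ Icc 0 T)
    (ht : t ∈ Icc 0 T) (k : ℤ) :
    fourierHat (fun x => (s - t)⁻¹ * (g s x - g t x) - g' t x) k
      = ((s - t)⁻¹ : ℝ) * (fourierHat (g s) k - fourierHat (g t) k) - fourierHat (g' t) k := by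
  have h1 : MemLp (fun x => g s x - g t x) 2 (volume.restrict (Ioc (0 : ℝ) 1)) :=
    (h.mem s hs).memLp.sub (h.mem t ht).memLp
  rw [fourierHat_sub (h1.const_mul _) (h.mem_deriv t ht).memLp, fourierHat_smul]
  congr 2
  exact fourierHat_sub (h.mem s hs).memLp (h.mem t ht).memLp k

theorem sobSummable_quotient (h : IsC1Sobolev T μ g g') {s t : ℝ} (hs : s ∈ Icc 0 T)
    (ht : t ∈ Icc 0 T) :
    SobSummable μ (fourierHat (fun x => (s - t)⁻¹ * (g s x - g t x) - g' t x)) := by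
  have e : fourierHat (fun x => (s - t)⁻¹ * (g s x - g t x) - g' t x) = fun k =>
      (((s - t)⁻¹ : ℝ) * (fourierHat (g s) k + (-1) * fourierHat (g t) k))
        + (-1) * fourierHat (g' t) k := by
    funext k
    rw [fourierHat_quotient h hs ht]
    ring
  rw [e]
  exact (((h.mem s hs).sobSummable.add ((h.mem t ht).sobSummable.const_mul _)).const_mul _).add
    ((h.mem_deriv t ht).sobSummable.const_mul _)

theorem IsC1Sobolev.hasDerivWithinAt_fourierHat (h : IsC1Sobolev T μ g g') (hμ : 0 ≤ μ) {t : ℝ}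
    (ht : t ∈ Icc 0 T) (k : ℤ) :
    HasDerivWithinAt (fun s => fourierHat (g s) k) (fourierHat (g' t) k) (Icc 0 T) t := by
  rw [hasDerivWithinAt_iff_tendsto_slope, tendsto_iff_norm_sub_tendsto_zero]
  refine squeeze_zero' (Eventually.of_forall fun s => norm_nonneg _) ?_ (h.hasDeriv t ht)
  filter_upwards [self_mem_nhdsWithin] with s hs
  refine le_of_sq_le_sq ?_ (sobolevNorm_nonneg _ _)
  rw [sobolevNorm_sq]
  refine le_trans (le_of_eq ?_) ((sobSummable_quotient h hs.1 ht).norm_sq_le hμ k)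
  rw [fourierHat_quotient h hs.1 ht, slope_def_module, Complex.real_smul]

/-- Differentiability at a time bounds the norm near that time, and compactness of `[0,T]` makes the
bound uniform. -/
theorem IsC1Sobolev.exists_bound (h : IsC1Sobolev T μ g g') :
    ∃ M, ∀ t ∈ Icc 0 T, sobSq μ (fourierHat (g t)) ≤ M := by
  refine isCompact_Icc.induction_on (p := fun S => ∃ M, ∀ t ∈ S, sobSq μ (fourierHat (g t)) ≤ M)
    ⟨0, by simp⟩ (fun s t hst ⟨M, hM⟩ => ⟨M, fun x hx => hM x (hst hx)⟩) ?_ ?_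
  · rintro s t ⟨M, hM⟩ ⟨M', hM'⟩
    refine ⟨max M M', fun x hx => ?_⟩
    rcases hx with hx | hx
    · exact (hM x hx).trans (le_max_left _ _)
    · exact (hM' x hx).trans (le_max_right _ _)
  · intro t ht
    have h1 := (h.hasDeriv t ht).eventually (gt_mem_nhds one_pos)
    rw [eventually_nhdsWithin_iff] at h1
    refine ⟨{s | s ∈ Icc 0 T ∧ (s ≠ t →
      sobolevNorm μ (fun x => (s - t)⁻¹ * (g s x - g t x) - g' t x) < 1)}, ?_,
      max (sobSq μ (fourierHat (g t))) (2 * sobSq μ (fourierHat (g t)) +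
        2 * (T ^ 2 * (2 * 1 + 2 * sobSq μ (fourierHat (g' t))))), ?_⟩
    · filter_upwards [self_mem_nhdsWithin, mem_nhdsWithin_of_mem_nhds h1] with s hs1 hs2
      exact ⟨hs1, fun hne => hs2 ⟨hs1, hne⟩⟩
    · rintro s ⟨hs, hq⟩
      by_cases hst : s = t
      · rw [hst]; exact le_max_left _ _
      · refine le_trans ?_ (le_max_right _ _)
        set Q := fourierHat (fun x => (s - t)⁻¹ * (g s x - g t x) - g' t x) with hQ
        have hQs := sobSummable_quotient h hs ht
        have hne : ((s - t : ℝ) : ℂ) ≠ 0 := by exact_mod_cast sub_ne_zero.mpr hst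
        -- `g(s) = g(t) + (s - t) (Q + g'(t))`, where the error `Q` of the difference quotient has
        -- norm below `1` near `t`, and `|s - t| ≤ T`.
        have e : fourierHat (g s) = fun k => fourierHat (g t) k +
            (fun k => ((s - t : ℝ) : ℂ) * (fun k => Q k + fourierHat (g' t) k) k) k := by
          funext k
          simp only [hQ, fourierHat_quotient h hs ht, Complex.ofReal_inv]
          field_simp
          ring
        have hsum := hQs.add (h.mem_deriv t ht).sobSummable
        rw [e]
        refine ((h.mem t ht).sobSummable.sobSq_add_le (hsum.const_mul _)).trans ?_
        rw [sobSq_const_mul, Complex.norm_real, Real.norm_eq_abs, sq_abs]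
        have h2 := hQs.sobSq_add_le (h.mem_deriv t ht).sobSummable
        have h3 : sobSq μ Q ≤ 1 := by
          rw [hQ, ← sobolevNorm_sq]
          exact pow_le_one₀ (sobolevNorm_nonneg _ _) (hq hst).le
        have h4 : (s - t) ^ 2 ≤ T ^ 2 := by
          have := hs.1; have := hs.2; have := ht.1; have := ht.2
          apply sq_le_sq'
          · linarith
          · linarith
        have h5 : sobSq μ (fun k => Q k + fourierHat (g' t) k)
            ≤ 2 * 1 + 2 * sobSq μ (fourierHat (g' t)) := by linarith
        have h6 := mul_le_mul h4 h5 (sobSq_nonneg _ _) (sq_nonneg T)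
        linarith

end C1

/-! ### Ordinary differential equations with a truncated vector field -/

section ODE

variable {E : Type*} [NormedAddCommGroup E] [NormedSpace ℝ E] [FiniteDimensional ℝ E]

theorem hasDerivWithinAt_Ici_of_Icc {F : Type*} [NormedAddCommGroup F] [NormedSpace ℝ F]
    {f : ℝ → F} {f' : F} {T t : ℝ} (ht : t ∈ Ico 0 T) (h : HasDerivWithinAt f f' (Icc 0 T) t) :
    HasDerivWithinAt f f' (Ici t) t :=
  h.mono_of_mem_nhdsWithin (Icc_mem_nhdsGE_of_mem ht)

/-- A `C¹` vector field becomes bounded and Lipschitz continuous after multiplication with a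
cutoff function. -/
theorem exists_cutoff {G : E → E} (hG : ContDiff ℝ 1 G) {R : ℝ} (hR : 0 < R) :
    ∃ (χ : E → ℝ) (K L : NNReal), (∀ y, ‖y‖ ≤ R → χ y = 1) ∧
      LipschitzWith K (fun y => χ y • G y) ∧ ∀ y, ‖χ y • G y‖ ≤ L := by
  let f : ContDiffBump (0 : E) := ⟨R, R + 1, hR, by linarith⟩
  have hc : HasCompactSupport (fun y => f y • G y) := f.hasCompactSupport.smul_right
  have hd : ContDiff ℝ 1 (fun y => f y • G y) := f.contDiff.smul hG
  obtain ⟨K, hK⟩ := ContDiff.lipschitzWith_of_hasCompactSupport hc hd one_ne_zero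
  obtain ⟨L, hL⟩ := hc.exists_bound_of_continuous hd.continuous
  refine ⟨f, K, L.toNNReal, fun y hy => f.one_of_mem_closedBall ?_, hK, fun y => ?_⟩
  · simpa using hy
  · exact (hL y).trans (Real.le_coe_toNNReal L)

/-- Global solutions of the truncated differential equation in the range of a projection `S`
which is compatible with the vector field. -/
theorem exists_truncated_solution {G : E → E} (hG : ContDiff ℝ 1 G) (S : E →L[ℝ] E)
    (hS : ∀ y, S (S y) = S y) (hGS : ∀ y, S (G (S y)) = G (S y)) {y₀ : E} (hy₀ : S y₀ = y₀)
    {T R : ℝ} (hT : 0 < T) (hR : 0 < R) :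
    ∃ (χ : E → ℝ) (y : ℝ → E), (∀ x, ‖x‖ ≤ R → χ x = 1) ∧ y 0 = y₀ ∧ (∀ t, S (y t) = y t) ∧
      ∀ t ∈ Icc 0 T, HasDerivWithinAt y (χ (y t) • G (y t)) (Icc 0 T) t := by
  obtain ⟨χ, K, L, hχ, hK, hL⟩ := exists_cutoff hG hR
  -- The field is evaluated at `S y`: if `α` solves this equation, then `S α` solves the cut-off
  -- one, since `S` fixes `G (S α)`. The cutoff itself need not commute with `S`.
  have hLip : LipschitzWith (K * ‖S‖₊) (fun y => χ (S y) • G (S y)) := hK.comp S.lipschitz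
  -- The field is bounded by `L` everywhere, so a ball of radius `L T` suffices for the whole
  -- interval.
  have hPL : IsPicardLindelof (fun _ y => χ (S y) • G (S y)) (tmin := 0) (tmax := T)
      ⟨0, le_rfl, hT.le⟩ y₀ (L * T.toNNReal) 0 L (K * ‖S‖₊) := by
    refine ⟨fun t _ => hLip.lipschitzOnWith, fun x _ => continuousOn_const,
      fun t _ x _ => hL (S x), ?_⟩
    simp [hT.le]
  obtain ⟨α, h0, hα⟩ := hPL.exists_eq_forall_mem_Icc_hasDerivWithinAt₀
  refine ⟨χ, fun t => S (α t), hχ, ?_, fun t => hS _, fun t ht => ?_⟩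
  · change S (α 0) = y₀
    rw [show α 0 = y₀ from h0, hy₀]
  · have h := S.hasFDerivAt.comp_hasDerivWithinAt t (hα t ht)
    rw [map_smul, hGS] at h
    exact h

/-- Both trajectories are bounded on the compact interval, and `G` is Lipschitz continuous on a ball
containing them. -/
theorem eqOn_of_hasDerivWithinAt {G : E → E} (hG : ContDiff ℝ 1 G) {T : ℝ} {y y' : ℝ → E}
    (hy : ∀ t ∈ Icc 0 T, HasDerivWithinAt y (G (y t)) (Icc 0 T) t)
    (hy' : ∀ t ∈ Icc 0 T, HasDerivWithinAt y' (G (y' t)) (Icc 0 T) t) (h0 : y 0 = y' 0) :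
    EqOn y y' (Icc 0 T) := by
  have c1 : ContinuousOn y (Icc 0 T) := fun t ht => (hy t ht).continuousWithinAt
  have c2 : ContinuousOn y' (Icc 0 T) := fun t ht => (hy' t ht).continuousWithinAt
  obtain ⟨C, hC⟩ := isCompact_Icc.exists_bound_of_continuousOn c1
  obtain ⟨C', hC'⟩ := isCompact_Icc.exists_bound_of_continuousOn c2
  obtain ⟨K, hK⟩ := (hG.contDiffOn (s := Metric.closedBall 0 (max C C'))).exists_lipschitzOnWith
    one_ne_zero (convex_closedBall _ _) (isCompact_closedBall _ _)
  refine ODE_solution_unique_of_mem_Icc_right (v := fun _ => G)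
    (s := fun _ => Metric.closedBall 0 (max C C')) (fun t _ => hK) c1
    (fun t ht => hasDerivWithinAt_Ici_of_Icc ht (hy t (Ico_subset_Icc_self ht)))
    (fun t ht => ?_) c2
    (fun t ht => hasDerivWithinAt_Ici_of_Icc ht (hy' t (Ico_subset_Icc_self ht)))
    (fun t ht => ?_) h0
  · rw [mem_closedBall_zero_iff]
    exact (hC t (Ico_subset_Icc_self ht)).trans (le_max_left _ _)
  · rw [mem_closedBall_zero_iff]
    exact (hC' t (Ico_subset_Icc_self ht)).trans (le_max_right _ _)

end ODE

/-! ### The phase space of the semidiscrete problem -/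

/-- The pairs of coefficient vectors with modes `|k| ≤ N`. -/
abbrev PhaseSpace (N : ℕ) : Type := (modes N → ℂ) × (modes N → ℂ)

section PhaseSpace

variable {N : ℕ}

/-- Extension of a coefficient vector by zero. -/
def extend (y : modes N → ℂ) (k : ℤ) : ℂ := if h : k ∈ modes N then y ⟨k, h⟩ else 0

theorem extend_of_mem (y : modes N → ℂ) {k : ℤ} (h : k ∈ modes N) : extend y k = y ⟨k, h⟩ :=
  dif_pos h

theorem extend_of_notMem (y : modes N → ℂ) {k : ℤ} (h : k ∉ modes N) : extend y k = 0 := dif_neg h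

theorem extend_restrict {z : ℤ → ℂ} (hz : ∀ k ∉ modes N, z k = 0) :
    extend (fun k : modes N => z k) = z := by
  funext k
  by_cases h : k ∈ modes N
  · rw [extend_of_mem _ h]
  · rw [extend_of_notMem _ h, hz k h]

theorem contDiff_extend_fst (k : ℤ) : ContDiff ℝ 1 (fun y : PhaseSpace N => extend y.1 k) := by
  by_cases h : k ∈ modes N
  · simp only [extend_of_mem _ h]
    exact (contDiff_apply ℝ ℂ (⟨k, h⟩ : modes N)).comp contDiff_fst
  · simp only [extend_of_notMem _ h]
    exact contDiff_const

theorem contDiff_extend_snd (k : ℤ) : ContDiff ℝ 1 (fun y : PhaseSpace N => extend y.2 k) := by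
  by_cases h : k ∈ modes N
  · simp only [extend_of_mem _ h]
    exact (contDiff_apply ℝ ℂ (⟨k, h⟩ : modes N)).comp contDiff_snd
  · simp only [extend_of_notMem _ h]
    exact contDiff_const

/-- The vector field of the semidiscrete problem. -/
def galerkinField (α β D : ℤ → ℝ) (l : ℝ) (y : PhaseSpace N) : PhaseSpace N :=
  (fun k => fieldFst α l (extend y.1) (extend y.2) k,
    fun k => fieldSnd β D l (extend y.1) (extend y.2) k)

theorem contDiff_galerkinField (α β D : ℤ → ℝ) (l : ℝ) :
    ContDiff ℝ 1 (galerkinField α β D l : PhaseSpace N → PhaseSpace N) := by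
  have h1 := contDiff_extend_fst (N := N)
  have h2 := contDiff_extend_snd (N := N)
  have c1 : ∀ y : PhaseSpace N, ∀ k, conv (extend y.1) (extend y.2) k
      = ∑ j ∈ modes N, extend y.1 j * extend y.2 (k - j) := fun y =>
    conv_eq_sum (fun _ h => extend_of_notMem _ h) _
  have c2 : ∀ y : PhaseSpace N, ∀ k, conv (extend y.2) (extend y.2) k
      = ∑ j ∈ modes N, extend y.2 j * extend y.2 (k - j) := fun y =>
    conv_eq_sum (fun _ h => extend_of_notMem _ h) _
  refine ContDiff.prodMk (contDiff_pi.mpr fun k => ?_) (contDiff_pi.mpr fun k => ?_)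
  · simp only [fieldFst, c1]
    exact contDiff_const.mul ((contDiff_const.mul (h2 k)).add (contDiff_const.mul
      (ContDiff.sum fun j _ => (h1 j).mul (h2 _))))
  · simp only [fieldSnd, c2]
    exact contDiff_const.mul ((contDiff_const.mul (h1 k)).add (contDiff_const.mul
      (ContDiff.sum fun j _ => (h2 j).mul (h2 _))))

/-- Restriction of a pair of sequences to the modes `|k| ≤ N`. -/
def restrictPair (N : ℕ) (z w : ℤ → ℂ) : PhaseSpace N := (fun k => z k, fun k => w k)

theorem IsCoeffSolution.hasDerivWithinAt {α β D : ℤ → ℝ} {l T : ℝ} {Z₀ U₀ : ℤ → ℂ}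
    {z w : ℝ → ℤ → ℂ} (h : IsCoeffSolution α β D l T N Z₀ U₀ z w) {t : ℝ} (ht : t ∈ Icc 0 T) :
    HasDerivWithinAt (fun s => restrictPair N (z s) (w s))
      (galerkinField α β D l (restrictPair N (z t) (w t))) (Icc 0 T) t := by
  unfold galerkinField restrictPair
  simp only [extend_restrict (h.supp_fst t ht), extend_restrict (h.supp_snd t ht)]
  exact HasDerivWithinAt.prodMk
    (hasDerivWithinAt_pi.mpr fun k => h.deriv_fst t ht k k.2)
    (hasDerivWithinAt_pi.mpr fun k => h.deriv_snd t ht k k.2)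

/-- Uniqueness for the semidiscrete problem. -/
theorem IsCoeffSolution.unique {α β D : ℤ → ℝ} {l T : ℝ} {Z₀ U₀ : ℤ → ℂ}
    {z w z' w' : ℝ → ℤ → ℂ} (h : IsCoeffSolution α β D l T N Z₀ U₀ z w)
    (h' : IsCoeffSolution α β D l T N Z₀ U₀ z' w') {t : ℝ} (ht : t ∈ Icc 0 T) :
    z t = z' t ∧ w t = w' t := by
  have e := eqOn_of_hasDerivWithinAt (contDiff_galerkinField α β D l)
    (fun t ht => h.hasDerivWithinAt ht) (fun t ht => h'.hasDerivWithinAt ht) (by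
      refine Prod.ext (funext fun k => ?_) (funext fun k => ?_)
      · exact (h.init_fst k k.2).trans (h'.init_fst k k.2).symm
      · exact (h.init_snd k k.2).trans (h'.init_snd k k.2).symm) ht
  constructor
  · rw [← extend_restrict (h.supp_fst t ht), ← extend_restrict (h'.supp_fst t ht)]
    exact congrArg (fun y : PhaseSpace N => extend y.1) e
  · rw [← extend_restrict (h.supp_snd t ht), ← extend_restrict (h'.supp_snd t ht)]
    exact congrArg (fun y : PhaseSpace N => extend y.2) e

/-- The real part of a coefficient vector, i.e. its projection onto the vectors of coefficients of
real trigonometric polynomials. -/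
def symmetrize (y : modes N → ℂ) (k : modes N) : ℂ :=
  (y k + conj (y ⟨-k, neg_mem_modes.mpr k.2⟩)) / 2

/-- The projection onto the pairs of coefficient vectors of real trigonometric polynomials. -/
def symProj (N : ℕ) : PhaseSpace N →L[ℝ] PhaseSpace N :=
  LinearMap.toContinuousLinearMap
    { toFun := fun y => (symmetrize y.1, symmetrize y.2)
      map_add' := fun y y' => by
        refine Prod.ext (funext fun k => ?_) (funext fun k => ?_) <;>
        · simp only [symmetrize, Prod.fst_add, Prod.snd_add, Pi.add_apply, map_add]
          ring
      map_smul' := fun r y => by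
        refine Prod.ext (funext fun k => ?_) (funext fun k => ?_) <;>
        · simp only [symmetrize, Prod.smul_fst, Prod.smul_snd, Pi.smul_apply, Complex.real_smul,
            map_mul, Complex.conj_ofReal, RingHom.id_apply]
          ring }

theorem symProj_apply (y : PhaseSpace N) : symProj N y = (symmetrize y.1, symmetrize y.2) := rfl

theorem extend_neg_of_symmetrize {y : modes N → ℂ} (h : symmetrize y = y) (k : ℤ) :
    extend y (-k) = conj (extend y k) := by
  by_cases hk : k ∈ modes N
  · have hk' := neg_mem_modes.mpr hk
    rw [extend_of_mem _ hk, extend_of_mem _ hk']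
    have e1 := congrFun h ⟨k, hk⟩
    have h2 : conj (2 : ℂ) = 2 := Complex.conj_ofNat 2
    have e2 := congrArg conj e1
    simp only [symmetrize, map_div₀, map_add, Complex.conj_conj, h2] at e1 e2
    linear_combination 2 * e2
  · rw [extend_of_notMem _ hk, extend_of_notMem _ fun h => hk (neg_mem_modes.mp h), map_zero]

theorem symmetrize_restrict {z : ℤ → ℂ} (hz : ∀ k, z (-k) = conj (z k)) :
    symmetrize (fun k : modes N => z k) = fun k : modes N => z k := by
  funext k
  simp only [symmetrize, hz, Complex.conj_conj]
  ring

theorem symmetrize_symmetrize (y : modes N → ℂ) : symmetrize (symmetrize y) = symmetrize y := by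
  funext k
  have h2 : conj (2 : ℂ) = 2 := Complex.conj_ofNat 2
  simp only [symmetrize, map_div₀, map_add, Complex.conj_conj, h2, neg_neg]
  ring

theorem conv_neg {f g : ℤ → ℂ} (hf : ∀ k, f (-k) = conj (f k)) (hg : ∀ k, g (-k) = conj (g k))
    (k : ℤ) : conv f g (-k) = conj (conv f g k) := by
  unfold conv
  rw [Complex.conj_tsum, ← (Equiv.neg ℤ).tsum_eq]
  refine tsum_congr fun j => ?_
  rw [map_mul, ← hf, ← hg]
  congr 2
  simp
  ring

theorem fieldFst_neg {α : ℤ → ℝ} {l : ℝ} {z w : ℤ → ℂ} (hα : ∀ k, α (-k) = α k)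
    (hz : ∀ k, z (-k) = conj (z k)) (hw : ∀ k, w (-k) = conj (w k)) (k : ℤ) :
    fieldFst α l z w (-k) = conj (fieldFst α l z w k) := by
  have h2 : conj (2 : ℂ) = 2 := Complex.conj_ofNat 2
  simp only [fieldFst, conv_neg hz hw, hα, hw, map_mul, map_add, map_neg, h2, Complex.conj_I,
    Complex.conj_ofReal, map_intCast, Int.cast_neg]
  ring

theorem fieldSnd_neg {β D : ℤ → ℝ} {l : ℝ} {z w : ℤ → ℂ} (hβ : ∀ k, β (-k) = β k)
    (hD : ∀ k, D (-k) = D k) (hz : ∀ k, z (-k) = conj (z k)) (hw : ∀ k, w (-k) = conj (w k))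
    (k : ℤ) : fieldSnd β D l z w (-k) = conj (fieldSnd β D l z w k) := by
  have h2 : conj (2 : ℂ) = 2 := Complex.conj_ofNat 2
  simp only [fieldSnd, conv_neg hw hw, hβ, hD, hz, map_mul, map_div₀, map_add, map_neg, h2,
    Complex.conj_I, Complex.conj_ofReal, map_intCast, Int.cast_neg]
  ring

/-- Solutions of the truncated semidiscrete problem. -/
theorem exists_truncated_coeff {α β D : ℤ → ℝ} (l : ℝ) (hα : ∀ k, α (-k) = α k)
    (hβ : ∀ k, β (-k) = β k) (hD : ∀ k, D (-k) = D k) {T R : ℝ} (hT : 0 < T) (hR : 0 < R) (N : ℕ)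
    {Z₀ U₀ : ℤ → ℂ} (hZ₀ : ∀ k, Z₀ (-k) = conj (Z₀ k)) (hU₀ : ∀ k, U₀ (-k) = conj (U₀ k)) :
    ∃ (r : ℝ → ℝ) (z w : ℝ → ℤ → ℂ),
      (∀ t, (∀ k, ‖z t k‖ ≤ R ∧ ‖w t k‖ ≤ R) → r t = 1) ∧
      (∀ t, ∀ k ∉ modes N, z t k = 0) ∧ (∀ t, ∀ k ∉ modes N, w t k = 0) ∧
      (∀ t k, z t (-k) = conj (z t k)) ∧ (∀ t k, w t (-k) = conj (w t k)) ∧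
      (∀ k ∈ modes N, z 0 k = Z₀ k) ∧ (∀ k ∈ modes N, w 0 k = U₀ k) ∧
      (∀ t ∈ Icc 0 T, ∀ k ∈ modes N, HasDerivWithinAt (fun s => z s k)
        (r t * fieldFst α l (z t) (w t) k) (Icc 0 T) t) ∧
      (∀ t ∈ Icc 0 T, ∀ k ∈ modes N, HasDerivWithinAt (fun s => w s k)
        (r t * fieldSnd β D l (z t) (w t) k) (Icc 0 T) t) := by
  -- The vector field maps coefficients of real functions to coefficients of real functions, because
  -- the symbols are even; so the reality condition is preserved by the flow.
  have hsym : ∀ y : PhaseSpace N, symProj N (galerkinField α β D l (symProj N y))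
      = galerkinField α β D l (symProj N y) := by
    intro y
    have e1 := extend_neg_of_symmetrize (symmetrize_symmetrize y.1)
    have e2 := extend_neg_of_symmetrize (symmetrize_symmetrize y.2)
    rw [symProj_apply, symProj_apply]
    exact Prod.ext (symmetrize_restrict (fieldFst_neg hα e1 e2))
      (symmetrize_restrict (fieldSnd_neg hβ hD e1 e2))
  obtain ⟨χ, y, hχ, h0, hS, hd⟩ := exists_truncated_solution (contDiff_galerkinField α β D l)
    (symProj N) (fun y => Prod.ext (symmetrize_symmetrize y.1) (symmetrize_symmetrize y.2)) hsym
    (y₀ := restrictPair N Z₀ U₀)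
    (Prod.ext (symmetrize_restrict hZ₀) (symmetrize_restrict hU₀)) hT hR
  refine ⟨fun t => χ (y t), fun t => extend (y t).1, fun t => extend (y t).2, fun t ht => ?_,
    fun t k hk => extend_of_notMem _ hk, fun t k hk => extend_of_notMem _ hk,
    fun t => extend_neg_of_symmetrize (congrArg Prod.fst (hS t)),
    fun t => extend_neg_of_symmetrize (congrArg Prod.snd (hS t)),
    fun k hk => ?_, fun k hk => ?_, fun t ht k hk => ?_, fun t ht k hk => ?_⟩
  · refine hχ _ ?_
    rw [Prod.norm_def, max_le_iff, pi_norm_le_iff_of_nonneg hR.le, pi_norm_le_iff_of_nonneg hR.le]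
    refine ⟨fun k => ?_, fun k => ?_⟩
    · exact (congrArg norm (extend_of_mem (y t).1 k.2)).symm.trans_le (ht k).1
    · exact (congrArg norm (extend_of_mem (y t).2 k.2)).symm.trans_le (ht k).2
  · exact (extend_of_mem _ hk).trans (congrFun (congrArg Prod.fst h0) ⟨k, hk⟩)
  · exact (extend_of_mem _ hk).trans (congrFun (congrArg Prod.snd h0) ⟨k, hk⟩)
  · simp only [extend_of_mem _ hk]
    have h := hasDerivWithinAt_pi.mp
      ((ContinuousLinearMap.fst ℝ (modes N → ℂ) (modes N → ℂ)).hasFDerivAt.comp_hasDerivWithinAt t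
        (hd t ht)) ⟨k, hk⟩
    refine h.congr_deriv ?_
    simp only [galerkinField, Prod.smul_mk, ContinuousLinearMap.coe_fst', Pi.smul_apply,
      Complex.real_smul]
  · simp only [extend_of_mem _ hk]
    have h := hasDerivWithinAt_pi.mp
      ((ContinuousLinearMap.snd ℝ (modes N → ℂ) (modes N → ℂ)).hasFDerivAt.comp_hasDerivWithinAt t
        (hd t ht)) ⟨k, hk⟩
    refine h.congr_deriv ?_
    simp only [galerkinField, Prod.smul_mk, ContinuousLinearMap.coe_snd', Pi.smul_apply,
      Complex.real_smul]

end PhaseSpace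

/-! ### The error estimate in Fourier variables -/

/-- Symbols `α`, `β`, `D` with the sizes of those of the system with `b = 0`, `d > 0` and
`a, c < 0`. -/
structure IsSymbol (α β D : ℤ → ℝ) (ρ g₀ : ℝ) : Prop where
  fst_pos : ∀ k, 0 < α k
  snd_pos : ∀ k, 0 < β k
  third_pos : ∀ k, 0 < D k
  fst_even : ∀ k, α (-k) = α k
  snd_even : ∀ k, β (-k) = β k
  third_even : ∀ k, D (-k) = D k
  ratio_le : ∀ k, α k / β k ≤ ρ
  const_pos : 0 < g₀
  le_weight : ∀ k, g₀ * wt k ^ 2 ≤ α k * D k / β k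

/-- Solutions of the system in Fourier variables which are bounded in `H^μ`. -/
structure IsExactCoeff (α β D : ℤ → ℝ) (l T μ M : ℝ) (Z U : ℝ → ℤ → ℂ) : Prop where
  sum_fst : ∀ t ∈ Icc 0 T, SobSummable μ (Z t)
  sum_snd : ∀ t ∈ Icc 0 T, SobSummable μ (U t)
  bound_fst : ∀ t ∈ Icc 0 T, sobSq μ (Z t) ≤ M
  bound_snd : ∀ t ∈ Icc 0 T, sobSq μ (U t) ≤ M
  deriv_fst : ∀ t ∈ Icc 0 T, ∀ k,
    HasDerivWithinAt (fun s => Z s k) (fieldFst α l (Z t) (U t) k) (Icc 0 T) t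
  deriv_snd : ∀ t ∈ Icc 0 T, ∀ k,
    HasDerivWithinAt (fun s => U s k) (fieldSnd β D l (Z t) (U t) k) (Icc 0 T) t

/-- The energy of the error of the semidiscretization. -/
def energy (α β D : ℤ → ℝ) (N : ℕ) (Z U z w : ℤ → ℂ) : ℝ :=
  ∑ k ∈ modes N, (‖Z k - z k‖ ^ 2 + α k * D k / β k * ‖U k - w k‖ ^ 2)

theorem hasDerivWithinAt_energy {α β D : ℤ → ℝ} {N : ℕ} {Z U z w : ℝ → ℤ → ℂ}
    {Z' U' z' w' : ℤ → ℂ} {s : Set ℝ} {t : ℝ}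
    (hZ : ∀ k ∈ modes N, HasDerivWithinAt (fun s => Z s k) (Z' k) s t)
    (hU : ∀ k ∈ modes N, HasDerivWithinAt (fun s => U s k) (U' k) s t)
    (hz : ∀ k ∈ modes N, HasDerivWithinAt (fun s => z s k) (z' k) s t)
    (hw : ∀ k ∈ modes N, HasDerivWithinAt (fun s => w s k) (w' k) s t) :
    HasDerivWithinAt (fun s => energy α β D N (Z s) (U s) (z s) (w s))
      (∑ k ∈ modes N, (2 * (conj (Z t k - z t k) * (Z' k - z' k)).re + α k * D k / β k *
        (2 * (conj (U t k - w t k) * (U' k - w' k)).re))) s t := by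
  unfold energy
  refine HasDerivWithinAt.fun_sum fun k hk => ?_
  have h1 := ((hZ k hk).sub (hz k hk)).norm_sq
  have h2 := (((hU k hk).sub (hw k hk)).norm_sq).const_mul (α k * D k / β k)
  refine (h1.add h2).congr_deriv ?_
  simp only [Complex.inner, Pi.sub_apply]
  rw [mul_comm (Z' k - z' k), mul_comm (U' k - w' k)]

section energy

variable {α β D : ℤ → ℝ} {ρ g₀ : ℝ} {N : ℕ} {Z U z w : ℤ → ℂ}

theorem sum_fst_le_energy (hs : IsSymbol α β D ρ g₀) :
    ∑ k ∈ modes N, ‖Z k - z k‖ ^ 2 ≤ energy α β D N Z U z w :=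
  Finset.sum_le_sum fun k _ => le_add_of_nonneg_right (mul_nonneg
    (div_nonneg (mul_nonneg (hs.fst_pos k).le (hs.third_pos k).le) (hs.snd_pos k).le)
    (sq_nonneg _))

theorem sum_snd_le_energy (hs : IsSymbol α β D ρ g₀) :
    ∑ k ∈ modes N, (wt k * ‖U k - w k‖) ^ 2 ≤ energy α β D N Z U z w / g₀ := by
  rw [le_div_iff₀ hs.const_pos, mul_comm, Finset.mul_sum]
  refine Finset.sum_le_sum fun k _ => ?_
  have := mul_le_mul_of_nonneg_right (hs.le_weight k) (sq_nonneg ‖U k - w k‖)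
  nlinarith [sq_nonneg ‖Z k - z k‖]

theorem tsum_wt_sub_sq_eq (hU : MemH1 U) (hw : ∀ k ∉ modes N, w k = 0) :
    ∑' k, (wt k * ‖U k - w k‖) ^ 2
      = ∑ k ∈ modes N, (wt k * ‖U k - w k‖) ^ 2 + ∑' k, (wt k * ‖tailPart (modes N) U k‖) ^ 2 := by
  have e : ∀ k, (wt k * ‖U k - w k‖) ^ 2 = (if k ∈ modes N then (wt k * ‖U k - w k‖) ^ 2 else 0)
      + (wt k * ‖tailPart (modes N) U k‖) ^ 2 := fun k => by
    unfold tailPart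
    split_ifs with hk
    · simp
    · rw [hw k hk, sub_zero, zero_add]
  rw [tsum_congr e, Summable.tsum_add (summable_of_ne_finset_zero (s := modes N)
    fun k hk => if_neg hk) (hU.tailPart _), tsum_eq_sum (s := modes N) fun k hk => if_neg hk]
  congr 1
  exact Finset.sum_congr rfl fun k hk => if_pos hk

/-- An inverse inequality: on `2N + 1 ≤ 3N` modes, Cauchy-Schwarz bounds the weighted `ℓ¹` norm of
the error by `√(3N)` times its weighted `ℓ²` norm, which the energy controls. This gives the missing
bound on the Galerkin solution. -/
theorem tsum_wt_approx_le (hs : IsSymbol α β D ρ g₀) (hN : 1 ≤ N) (hU : MemW1 U)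
    (hw : ∀ k ∉ modes N, w k = 0) (hE : 3 * N * energy α β D N Z U z w ≤ g₀) :
    ∑' k, wt k * ‖w k‖ ≤ ∑' k, wt k * ‖U k‖ + 1 := by
  have h1 := sum_snd_le_energy (N := N) (Z := Z) (U := U) (z := z) (w := w) hs
  have hE' : energy α β D N Z U z w / g₀ * (3 * N) ≤ 1 := by
    rw [div_mul_eq_mul_div, div_le_one hs.const_pos]
    linarith
  have h2 : (∑ k ∈ modes N, wt k * ‖U k - w k‖) ^ 2 ≤ 1 := by
    refine sq_sum_le_card_mul_sum_sq.trans ?_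
    have hc : ((modes N).card : ℝ) ≤ 3 * N := by
      have : (modes N).card = 2 * N + 1 := by
        rw [Int.card_Icc]
        omega
      rw [this]
      have : (1 : ℝ) ≤ N := by exact_mod_cast hN
      push_cast
      linarith
    have h0 : 0 ≤ ∑ k ∈ modes N, (wt k * ‖U k - w k‖) ^ 2 :=
      Finset.sum_nonneg fun k _ => sq_nonneg _
    calc _ ≤ 3 * N * ∑ k ∈ modes N, (wt k * ‖U k - w k‖) ^ 2 := mul_le_mul_of_nonneg_right hc h0
      _ ≤ 3 * N * (energy α β D N Z U z w / g₀) := mul_le_mul_of_nonneg_left h1 (by positivity)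
      _ ≤ 1 := by linarith
  have h3 : ∑ k ∈ modes N, wt k * ‖U k - w k‖ ≤ 1 := le_of_sq_le_sq (by simpa using h2) zero_le_one
  rw [tsum_eq_sum (s := modes N) fun k hk => by rw [hw k hk, norm_zero, mul_zero]]
  refine le_trans (Finset.sum_le_sum fun k _ => ?_) ((Finset.sum_add_distrib
    (f := fun k => wt k * ‖U k‖) (g := fun k => wt k * ‖U k - w k‖)).trans_le
    (add_le_add (hU.sum_le_tsum _ fun k _ => wt_mul_norm_nonneg U k) h3))
  rw [← mul_add]
  refine mul_le_mul_of_nonneg_left ?_ (wt_nonneg k)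
  have := norm_sub_le (U k) (U k - w k)
  rwa [sub_sub_cancel] at this

end energy

/-- The bound for the weighted `ℓ¹` norms in the energy estimate. -/
def ellOneBound (μ M : ℝ) : ℝ := (∑' k, wt k ^ 2 * sobWt (-μ) k + M) / 2 + 1

/-- The growth rate of the energy. -/
def growthRate (l μ M ρ g₀ : ℝ) : ℝ :=
  2 * Real.pi * |l| * ellOneBound μ M * (3 + 2 * ρ) * (1 + 1 / g₀ + 4 * M) + 1

/-- The energy estimate at a time where the energy is small. -/
theorem sum_energyRate_lt {α β D : ℤ → ℝ} {l μ M ρ g₀ : ℝ} {N : ℕ} {Z U z w : ℤ → ℂ}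
    (hs : IsSymbol α β D ρ g₀) (hμ : 3 / 2 < μ) (hN : 1 ≤ N)
    (hZ : SobSummable μ Z) (hU : SobSummable μ U) (hZM : sobSq μ Z ≤ M) (hUM : sobSq μ U ≤ M)
    (hz : ∀ k ∉ modes N, z k = 0) (hw : ∀ k ∉ modes N, w k = 0)
    (hreal : ∀ k, w (-k) = conj (w k))
    (hE : 3 * N * energy α β D N Z U z w ≤ g₀)
    (hE' : ((N : ℝ) ^ (1 - μ)) ^ 2 ≤ energy α β D N Z U z w) :
    ∑ k ∈ modes N, energyRate α β D l Z U z w k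
      < growthRate l μ M ρ g₀ * energy α β D N Z U z w := by
  have hμ1 : 1 ≤ μ := by linarith
  have hM : 0 ≤ M := (sobSq_nonneg μ Z).trans hZM
  have hρ : 0 ≤ ρ := (div_nonneg (hs.fst_pos 0).le (hs.snd_pos 0).le).trans (hs.ratio_le 0)
  have hg := hs.const_pos
  have hZ1 : ∑' k, wt k * ‖Z k‖ ≤ ellOneBound μ M := by
    refine (hZ.tsum_wt_le hμ).trans ?_
    unfold ellOneBound
    linarith
  have hU1 : ∑' k, wt k * ‖U k‖ + 1 ≤ ellOneBound μ M := by
    refine (add_le_add_left (hU.tsum_wt_le hμ) 1).trans ?_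
    unfold ellOneBound
    linarith
  have hw1 := (tsum_wt_approx_le (Z := Z) (z := z) hs hN (hU.memW1 hμ) hw hE).trans hU1
  have h := sum_energyRate_le (l := l) hs.fst_pos hs.snd_pos hs.third_pos hs.ratio_le
    (hZ.memW1 hμ) (hU.memW1 hμ) (hZ.memH1 hμ1) (hU.memH1 hμ1) hz hw hreal hZ1
    (by linarith) hw1
  have e1 := sum_fst_le_energy (N := N) (Z := Z) (U := U) (z := z) (w := w) hs
  have e2 := sum_snd_le_energy (N := N) (Z := Z) (U := U) (z := z) (w := w) hs
  have t1 := hZ.tsum_wt_tailPart_le hμ1 hN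
  have t2 := hU.tsum_wt_tailPart_le hμ1 hN
  have hε : 0 < ((N : ℝ) ^ (1 - μ)) ^ 2 := by
    have : (0 : ℝ) < N := by exact_mod_cast hN
    positivity
  rw [tsum_wt_sub_sq_eq (hU.memH1 hμ1) hw] at h
  set E := energy α β D N Z U z w with hEdef
  have hE0 : 0 < E := hε.trans_le hE'
  -- The truncation error `N^{2(1-μ)} M` is absorbed into `M` times the energy, which is possible
  -- because the energy is at least `N^{2(1-μ)}` here.
  have t3 := mul_le_mul hE' hZM (sobSq_nonneg _ _) hE0.le
  have t4 := mul_le_mul hE' hUM (sobSq_nonneg _ _) hE0.le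
  have hL : 0 ≤ ellOneBound μ M := (tsum_nonneg (wt_mul_norm_nonneg Z)).trans hZ1
  refine lt_of_le_of_lt (h.trans (mul_le_mul_of_nonneg_left
    (b := ∑ k ∈ modes N, ‖Z k - z k‖ ^ 2 + (∑ k ∈ modes N, (wt k * ‖U k - w k‖) ^ 2 +
        ∑' k, (wt k * ‖tailPart (modes N) U k‖) ^ 2) +
        ∑' k, (wt k * ‖tailPart (modes N) Z k‖) ^ 2)
    (c := (1 + 1 / g₀ + 4 * M) * E) ?_ (by positivity))) ?_
  -- The three terms bound the error of `ζ`, the error of `u`, and the two tails, each at most `2 E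
  -- M`.
  · have e3 : (1 + 1 / g₀ + 4 * M) * E = E + E / g₀ + 4 * (E * M) := by ring
    rw [e3]
    linarith
  -- The summand `1` in the rate and `E > 0` make the inequality strict, as the barrier argument
  -- requires.
  · unfold growthRate
    linarith

/-- The a priori estimate: the energy stays below `N^{2(1-μ)} e^{κt}` as long as the Galerkin
equations hold at the times where this bound is attained. -/
theorem energy_le {α β D : ℤ → ℝ} {l T μ M ρ g₀ : ℝ} {N : ℕ} {Z U z w p q : ℝ → ℤ → ℂ}
    (hs : IsSymbol α β D ρ g₀) (hT : 0 < T) (hμ : 3 / 2 < μ) (hN : 1 ≤ N)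
    (hN' : 3 * N * (((N : ℝ) ^ (1 - μ)) ^ 2 * Real.exp (growthRate l μ M ρ g₀ * T)) ≤ g₀)
    (hex : IsExactCoeff α β D l T μ M Z U)
    (hz : ∀ t ∈ Icc 0 T, ∀ k ∉ modes N, z t k = 0)
    (hw : ∀ t ∈ Icc 0 T, ∀ k ∉ modes N, w t k = 0)
    (hreal : ∀ t ∈ Icc 0 T, ∀ k, w t (-k) = conj (w t k))
    (hz' : ∀ t ∈ Icc 0 T, ∀ k ∈ modes N, HasDerivWithinAt (fun s => z s k) (p t k) (Icc 0 T) t)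
    (hw' : ∀ t ∈ Icc 0 T, ∀ k ∈ modes N, HasDerivWithinAt (fun s => w s k) (q t k) (Icc 0 T) t)
    (hpq : ∀ t ∈ Icc 0 T, energy α β D N (Z t) (U t) (z t) (w t)
        = ((N : ℝ) ^ (1 - μ)) ^ 2 * Real.exp (growthRate l μ M ρ g₀ * t) →
      ∀ k ∈ modes N, p t k = fieldFst α l (z t) (w t) k ∧ q t k = fieldSnd β D l (z t) (w t) k)
    (hz0 : ∀ k ∈ modes N, z 0 k = Z 0 k) (hw0 : ∀ k ∈ modes N, w 0 k = U 0 k)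
    {t : ℝ} (ht : t ∈ Icc 0 T) :
    energy α β D N (Z t) (U t) (z t) (w t)
      ≤ ((N : ℝ) ^ (1 - μ)) ^ 2 * Real.exp (growthRate l μ M ρ g₀ * t) := by
  set κ := growthRate l μ M ρ g₀ with hκ
  set ε := (N : ℝ) ^ (1 - μ) with hεdef
  have hε : 0 < ε ^ 2 := by
    have : (0 : ℝ) < N := by exact_mod_cast hN
    positivity
  have h0T : (0 : ℝ) ∈ Icc 0 T := ⟨le_rfl, hT.le⟩
  have hM : 0 ≤ M := (sobSq_nonneg μ (Z 0)).trans (hex.bound_fst 0 h0T)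
  have hρ : 0 ≤ ρ := (div_nonneg (hs.fst_pos 0).le (hs.snd_pos 0).le).trans (hs.ratio_le 0)
  have hL : 0 ≤ ellOneBound μ M := by
    have : 0 ≤ ∑' k, wt k ^ 2 * sobWt (-μ) k := tsum_nonneg fun k => mul_nonneg (sq_nonneg (wt k)) (sobWt_nonneg (-μ) k)
    unfold ellOneBound
    linarith
  have hκ0 : 0 ≤ κ := by
    have := hs.const_pos
    rw [hκ]
    unfold growthRate
    positivity
  have hd : ∀ t ∈ Icc 0 T, HasDerivWithinAt (fun s => energy α β D N (Z s) (U s) (z s) (w s))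
      (∑ k ∈ modes N, (2 * (conj (Z t k - z t k) * (fieldFst α l (Z t) (U t) k - p t k)).re +
        α k * D k / β k *
        (2 * (conj (U t k - w t k) * (fieldSnd β D l (Z t) (U t) k - q t k)).re))) (Icc 0 T) t :=
    fun t ht => hasDerivWithinAt_energy (fun k _ => hex.deriv_fst t ht k)
      (fun k _ => hex.deriv_snd t ht k) (hz' t ht) (hw' t ht)
  have hB : ∀ t : ℝ, HasDerivAt (fun t => ε ^ 2 * Real.exp (κ * t))
      (κ * (ε ^ 2 * Real.exp (κ * t))) t := fun t => by
    have := (((hasDerivAt_id t).const_mul κ).exp).const_mul (ε ^ 2)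
    refine this.congr_deriv ?_
    simp only [id, mul_one]
    ring
  -- The derivatives are compared only at times where the energy equals the barrier. There the
  -- smallness assumption on `N` and the lower bound `N^{2(1-μ)}` are both available.
  refine image_le_of_deriv_right_lt_deriv_boundary
    (fun t ht => (hd t ht).continuousWithinAt)
    (fun t ht => hasDerivWithinAt_Ici_of_Icc ht (hd t (Ico_subset_Icc_self ht))) ?_ hB ?_ ht
  · have : energy α β D N (Z 0) (U 0) (z 0) (w 0) = 0 := Finset.sum_eq_zero fun k hk => by
      rw [hz0 k hk, hw0 k hk]
      simp
    rw [this]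
    positivity
  · intro t ht hEB
    have ht' := Ico_subset_Icc_self ht
    have hpq' := hpq t ht' hEB
    have e : ∑ k ∈ modes N, (2 * (conj (Z t k - z t k) * (fieldFst α l (Z t) (U t) k - p t k)).re +
        α k * D k / β k *
        (2 * (conj (U t k - w t k) * (fieldSnd β D l (Z t) (U t) k - q t k)).re))
        = ∑ k ∈ modes N, energyRate α β D l (Z t) (U t) (z t) (w t) k :=
      Finset.sum_congr rfl fun k hk => by rw [(hpq' k hk).1, (hpq' k hk).2, energyRate]
    rw [e, ← hEB]
    refine sum_energyRate_lt hs hμ hN (hex.sum_fst t ht') (hex.sum_snd t ht')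
      (hex.bound_fst t ht') (hex.bound_snd t ht') (hz t ht') (hw t ht') (hreal t ht') ?_ ?_
    · rw [hEB]
      refine le_trans (mul_le_mul_of_nonneg_left ?_ (by positivity)) hN'
      refine mul_le_mul_of_nonneg_left (Real.exp_le_exp.mpr ?_) hε.le
      exact mul_le_mul_of_nonneg_left ht.2.le hκ0
    · rw [hEB]
      exact le_mul_of_one_le_right hε.le (Real.one_le_exp (mul_nonneg hκ0 ht.1))

theorem IsCoeffSolution.energy_le {α β D : ℤ → ℝ} {l T μ M ρ g₀ : ℝ} {N : ℕ}
    {Z U z w : ℝ → ℤ → ℂ} (hs : IsSymbol α β D ρ g₀) (hT : 0 < T) (hμ : 3 / 2 < μ) (hN : 1 ≤ N)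
    (hN' : 3 * N * (((N : ℝ) ^ (1 - μ)) ^ 2 * Real.exp (growthRate l μ M ρ g₀ * T)) ≤ g₀)
    (hex : IsExactCoeff α β D l T μ M Z U)
    (h : IsCoeffSolution α β D l T N (Z 0) (U 0) z w) {t : ℝ} (ht : t ∈ Icc 0 T) :
    energy α β D N (Z t) (U t) (z t) (w t)
      ≤ ((N : ℝ) ^ (1 - μ)) ^ 2 * Real.exp (growthRate l μ M ρ g₀ * t) :=
  BoussinesqSpectral.energy_le hs hT hμ hN hN' hex h.supp_fst h.supp_snd h.real_snd h.deriv_fst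
    h.deriv_snd (fun _ _ _ _ _ => ⟨rfl, rfl⟩) h.init_fst h.init_snd ht

/-- Existence for the semidiscrete problem. -/
theorem exists_isCoeffSolution {α β D : ℤ → ℝ} {l T μ M ρ g₀ : ℝ} {N : ℕ}
    {Z U : ℝ → ℤ → ℂ} (hs : IsSymbol α β D ρ g₀) (hT : 0 < T) (hμ : 3 / 2 < μ) (hN : 1 ≤ N)
    (hN' : 3 * N * (((N : ℝ) ^ (1 - μ)) ^ 2 * Real.exp (growthRate l μ M ρ g₀ * T)) ≤ g₀)
    (hex : IsExactCoeff α β D l T μ M Z U)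
    (hZ0 : ∀ k, Z 0 (-k) = conj (Z 0 k)) (hU0 : ∀ k, U 0 (-k) = conj (U 0 k)) :
    ∃ z w, IsCoeffSolution α β D l T N (Z 0) (U 0) z w := by
  set κ := growthRate l μ M ρ g₀ with hκ
  have h0T : (0 : ℝ) ∈ Icc 0 T := ⟨le_rfl, hT.le⟩
  have hM : 0 ≤ M := (sobSq_nonneg μ (Z 0)).trans (hex.bound_fst 0 h0T)
  have hg := hs.const_pos
  set B : ℝ := ((N : ℝ) ^ (1 - μ)) ^ 2 * Real.exp (|κ| * T) with hB
  have hB0 : 0 ≤ B := by positivity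
  -- The radius covers every coefficient while the energy is at most `B`: `M` bounds the squared
  -- exact coefficients, `B` and `B / g₀` the squared errors; see `hbound`.
  set R : ℝ := 1 + 2 * M + 2 * B + 2 * (B / g₀) with hR
  have hR0 : 0 < R := by positivity
  obtain ⟨r, z, w, hr, hz, hw, hzr, hwr, hz0, hw0, hz', hw'⟩ := exists_truncated_coeff l hs.fst_even
    hs.snd_even hs.third_even hT hR0 N hZ0 hU0
  have hball : ∀ t ∈ Icc 0 T, energy α β D N (Z t) (U t) (z t) (w t)
      ≤ ((N : ℝ) ^ (1 - μ)) ^ 2 * Real.exp (κ * t) → r t = 1 := by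
    intro t ht hE
    have hEB : energy α β D N (Z t) (U t) (z t) (w t) ≤ B := by
      refine hE.trans (mul_le_mul_of_nonneg_left (Real.exp_le_exp.mpr ?_) (sq_nonneg _))
      exact mul_le_mul (le_abs_self κ) ht.2 ht.1 (abs_nonneg κ)
    have hbound : ∀ {a b : ℂ} {x y : ℝ}, ‖a‖ ^ 2 ≤ x → ‖a - b‖ ^ 2 ≤ y →
        ‖b‖ ≤ 1 + 2 * x + 2 * y := by
      intro a b x y h1 h2
      have h3 : ‖b‖ ≤ ‖a‖ + ‖a - b‖ := by
        have := norm_sub_le a (a - b)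
        rwa [sub_sub_cancel] at this
      nlinarith [sq_nonneg (‖a‖ - 1), sq_nonneg (‖a - b‖ - 1), sq_nonneg ‖a‖, sq_nonneg ‖a - b‖]
    refine hr t fun k => ?_
    by_cases hk : k ∈ modes N
    · have e1 : ‖Z t k - z t k‖ ^ 2 ≤ B :=
        (Finset.single_le_sum (f := fun k => ‖Z t k - z t k‖ ^ 2) (fun _ _ => sq_nonneg _) hk).trans
          ((sum_fst_le_energy hs).trans hEB)
      have e2 : ‖U t k - w t k‖ ^ 2 ≤ B / g₀ := by
        refine le_trans ?_ ((Finset.single_le_sum (f := fun k => (wt k * ‖U t k - w t k‖) ^ 2)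
          (fun _ _ => sq_nonneg _) hk).trans ((sum_snd_le_energy (Z := Z t) (z := z t) hs).trans
            (div_le_div_of_nonneg_right hEB hg.le)))
        exact pow_le_pow_left₀ (norm_nonneg _)
          (le_mul_of_one_le_left (norm_nonneg _) (one_le_wt k)) 2
      have hBg : 0 ≤ B / g₀ := by positivity
      constructor
      · have := hbound (((hex.sum_fst t ht).norm_sq_le (by linarith) k).trans
          (hex.bound_fst t ht)) e1
        linarith
      · have := hbound (((hex.sum_snd t ht).norm_sq_le (by linarith) k).trans
          (hex.bound_snd t ht)) e2
        linarith
    · rw [hz t k hk, hw t k hk, norm_zero]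
      exact ⟨hR0.le, hR0.le⟩
  have hE : ∀ t ∈ Icc 0 T, energy α β D N (Z t) (U t) (z t) (w t)
      -- When the energy meets the barrier the solution is still inside the ball, so the cutoff is
      -- `1` and the true Galerkin equations hold. This avoids a continuation argument.
      ≤ ((N : ℝ) ^ (1 - μ)) ^ 2 * Real.exp (κ * t) := fun t ht =>
    BoussinesqSpectral.energy_le hs hT hμ hN hN' hex (fun t _ => hz t) (fun t _ => hw t)
      (fun t _ => hwr t) hz' hw' (fun t ht hEB k _ => by
        rw [hball t ht hEB.le, Complex.ofReal_one, one_mul, one_mul]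
        exact ⟨rfl, rfl⟩) hz0 hw0 ht
  have hr1 : ∀ t ∈ Icc 0 T, r t = 1 := fun t ht => hball t ht (hE t ht)
  refine ⟨z, w, fun t _ => hz t, fun t _ => hw t, fun t _ => hzr t, fun t _ => hwr t,
    fun t ht k hk => ?_, fun t ht k hk => ?_, hz0, hw0⟩
  · have := hz' t ht k hk
    rwa [hr1 t ht, Complex.ofReal_one, one_mul] at this
  · have := hw' t ht k hk
    rwa [hr1 t ht, Complex.ofReal_one, one_mul] at this

/-! ### The error estimate -/

theorem symD_neg (d : ℝ) (k : ℤ) : symD d (-k) = symD d k := by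
  unfold symD
  push_cast
  ring

theorem symFst_neg (γ δ a : ℝ) (k : ℤ) : symFst γ δ a (-k) = symFst γ δ a k := by
  unfold symFst
  push_cast
  ring

theorem symSnd_neg (γ c : ℝ) (k : ℤ) : symSnd γ c (-k) = symSnd γ c k := by
  unfold symSnd
  push_cast
  ring

theorem wt_sq_le_symD {d : ℝ} (hd : 0 < d) (k : ℤ) :
    d / (1 + d) / 2 * wt k ^ 2 ≤ symD d k := by
  have h1 := wt_sq_le k
  rw [sobWt_one] at h1
  -- `d / (1 + d)` lies below both `1` and `d`, so it serves the constant and the quadratic term of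
  -- the symbol at once.
  have h2 : d / (1 + d) ≤ 1 := by rw [div_le_one (by linarith)]; linarith
  have h3 : d / (1 + d) ≤ d := div_le_self hd.le (by linarith)
  have h4 : 1 ≤ (2 * Real.pi) ^ 2 := by nlinarith [Real.pi_gt_three]
  have h5 : 0 ≤ d / (1 + d) := by positivity
  have h6 := mul_le_mul_of_nonneg_left h1 h5
  have h7 := mul_le_mul_of_nonneg_right h3 (sq_nonneg (k : ℝ))
  have h8 := mul_le_mul_of_nonneg_left h4 (mul_nonneg hd.le (sq_nonneg (k : ℝ)))
  unfold symD
  rw [mul_pow]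
  linarith

/-- A quotient of affine functions with positive coefficients is bounded on the half-line. -/
theorem affine_div_le {p q r s x : ℝ} (hp : 0 < p) (hq : 0 < q) (hr : 0 < r) (hs : 0 < s)
    (hx : 0 ≤ x) : (p + q * x) / (r + s * x) ≤ p / r + q / s := by
  rw [div_le_iff₀ (by positivity)]
  have e : (p / r + q / s) * (r + s * x) = p + q * x + (q / s * r + p / r * (s * x)) := by
    field_simp
    ring
  rw [e]
  exact le_add_of_nonneg_right (by positivity)

/-- Both `α` and `β` are affine in `(2πk)²` with positive coefficients, so their ratio is bounded
from above and away from zero; the growth of the energy weight is then that of `D`. -/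
theorem exists_isSymbol {γ δ a c d : ℝ} (hγ₀ : 0 ≤ γ) (hγ₁ : γ < 1) (hδ : 0 < δ) (hd : 0 < d)
    (ha : a < 0) (hc : c < 0) :
    ∃ ρ g₀, IsSymbol (symFst γ δ a) (symSnd γ c) (symD d) ρ g₀ := by
  have k1 : 0 < kappa₁ γ δ := by unfold kappa₁; positivity
  have k2 : 0 < kappa₂ γ := by unfold kappa₂; linarith
  have ha' : 0 < -a := by linarith
  have hc' : 0 < -cPrime γ c := by
    unfold cPrime
    nlinarith
  have e1 : ∀ k, symFst γ δ a k = kappa₁ γ δ + -a * (2 * Real.pi * k) ^ 2 := fun k => by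
    unfold symFst; ring
  have e2 : ∀ k, symSnd γ c k = kappa₂ γ + -cPrime γ c * (2 * Real.pi * k) ^ 2 := fun k => by
    unfold symSnd; ring
  have h1 : ∀ k, 0 < symFst γ δ a k := fun k => by rw [e1]; positivity
  have h2 : ∀ k, 0 < symSnd γ c k := fun k => by rw [e2]; positivity
  set r := kappa₂ γ / kappa₁ γ δ + -cPrime γ c / -a with hr
  have hr0 : 0 < r := by positivity
  refine ⟨kappa₁ γ δ / kappa₂ γ + -a / -cPrime γ c, r⁻¹ * (d / (1 + d) / 2), h1, h2, symD_pos hd,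
    symFst_neg γ δ a, symSnd_neg γ c, symD_neg d, fun k => ?_, by positivity, fun k => ?_⟩
  · rw [e1, e2]
    exact affine_div_le k1 ha' k2 hc' (sq_nonneg _)
  · have h3 : r⁻¹ ≤ symFst γ δ a k / symSnd γ c k := by
      rw [inv_le_comm₀ hr0 (div_pos (h1 k) (h2 k)), inv_div, e1, e2]
      exact affine_div_le k2 hc' k1 ha' (sq_nonneg _)
    rw [mul_div_right_comm, mul_assoc]
    exact mul_le_mul h3 (wt_sq_le_symD hd k)
      (mul_nonneg (by positivity) (sq_nonneg _)) (div_pos (h1 k) (h2 k)).le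

theorem exists_isExactCoeff {γ δ a b c d T μ : ℝ} (hb : b = 0) (hd : 0 < d) (hμ : 0 ≤ μ)
    {ζ₀ u₀ : ℝ → ℝ} {ζ u ζt ut : ℝ → ℝ → ℝ}
    (hζ : IsC1Sobolev T μ ζ ζt) (hu : IsC1Sobolev T μ u ut)
    (hsol : IsSolution γ δ a b c d T ζ₀ u₀ ζ u ζt ut) :
    ∃ M, IsExactCoeff (symFst γ δ a) (symSnd γ c) (symD d) (lam γ δ) T μ M
      (fun t => fourierHat (ζ t)) (fun t => fourierHat (u t)) := by
  obtain ⟨M, hM⟩ := hζ.exists_bound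
  obtain ⟨M', hM'⟩ := hu.exists_bound
  refine ⟨max M M', fun t ht => (hζ.mem t ht).sobSummable, fun t ht => (hu.mem t ht).sobSummable,
    fun t ht => (hM t ht).trans (le_max_left _ _), fun t ht => (hM' t ht).trans (le_max_right _ _),
    fun t ht k => ?_, fun t ht k => ?_⟩
  · rw [← hsol.fourierHat_fst hb ht (hζ.mem t ht).memLp (hu.mem t ht).memLp]
    exact hζ.hasDerivWithinAt_fourierHat hμ ht k
  · rw [← hsol.fourierHat_snd hd ht (hu.mem t ht).memLp]
    exact hu.hasDerivWithinAt_fourierHat hμ ht k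

/-- The error splits into its low modes, where the energy acts, and the tail of the exact solution.
The rate `N^{1-μ}` of the tail in `H¹` is used for all `σ ≤ 1`, since the energy bound is no better.
-/
theorem sobSq_sub_le {σ μ M : ℝ} {N : ℕ} {A z : ℤ → ℂ} (hσ : σ ≤ 1) (hμ : 1 ≤ μ) (hN : 1 ≤ N)
    (hA : SobSummable μ A) (hAM : sobSq μ A ≤ M) (hz : ∀ k ∉ modes N, z k = 0) :
    sobSq σ (fun k => z k - A k)
      ≤ ∑ k ∈ modes N, sobWt σ k * ‖A k - z k‖ ^ 2 + ((N : ℝ) ^ (1 - μ)) ^ 2 * M := by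
  have e : ∀ k, sobWt σ k * ‖z k - A k‖ ^ 2
      = (if k ∈ modes N then sobWt σ k * ‖A k - z k‖ ^ 2 else 0)
        + sobWt σ k * ‖tailPart (modes N) A k‖ ^ 2 := fun k => by
    unfold tailPart
    split_ifs with hk
    · rw [norm_sub_rev]
      simp
    · rw [hz k hk, zero_sub, norm_neg, zero_add]
  have hN' : (1 : ℝ) ≤ N := by exact_mod_cast hN
  have h1 : sobSq σ (tailPart (modes N) A) ≤ ((N : ℝ) ^ (1 - μ)) ^ 2 * M := by
    refine (hA.sobSq_tailPart_le (hσ.trans hμ) hN).trans (mul_le_mul ?_ hAM (sobSq_nonneg _ _)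
      (sq_nonneg _))
    refine pow_le_pow_left₀ (by positivity) ?_ 2
    exact Real.rpow_le_rpow_of_exponent_le hN' (by linarith)
  refine le_trans (le_of_eq ?_) (add_le_add_right h1 _)
  rw [sobSq, tsum_congr e, Summable.tsum_add (summable_of_ne_finset_zero (s := modes N)
    fun k hk => if_neg hk) ((hA.mono (hσ.trans hμ)).tailPart _),
    tsum_eq_sum (s := modes N) fun k hk => if_neg hk]
  congr 1
  exact Finset.sum_congr rfl fun k hk => if_pos hk

theorem fourierHat_trigPoly_sub {N : ℕ} {v g : ℝ → ℝ} {z : ℤ → ℂ} (hv : IsTrigPoly N v z)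
    (hg : MemLp g 2 (volume.restrict (Ioc (0 : ℝ) 1))) :
    fourierHat (fun x => v x - g x) = fun k => fourierHat v k - fourierHat g k :=
  funext fun k => fourierHat_sub hv.memLp hg k

/-- The error of an approximation by trigonometric polynomials in terms of the energy. -/
theorem error_le_of_energy_le {α β D : ℤ → ℝ} {μ M ρ g₀ η : ℝ} {N : ℕ} {ζ u v w : ℝ → ℝ}
    (hs : IsSymbol α β D ρ g₀) (hμ : 1 ≤ μ) (hN : 1 ≤ N) (hζ : MemSobolev μ ζ)
    (hu : MemSobolev μ u) (hζM : sobSq μ (fourierHat ζ) ≤ M) (huM : sobSq μ (fourierHat u) ≤ M)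
    (hv : IsTrigPoly N v (fourierHat v)) (hw : IsTrigPoly N w (fourierHat w))
    (hE : energy α β D N (fourierHat ζ) (fourierHat u) (fourierHat v) (fourierHat w) ≤ η) :
    l2Norm (fun x => v x - ζ x) + sobolevNorm 1 (fun x => w x - u x)
      ≤ Real.sqrt (η + ((N : ℝ) ^ (1 - μ)) ^ 2 * M)
        + Real.sqrt (η / g₀ + ((N : ℝ) ^ (1 - μ)) ^ 2 * M) := by
  have hm : MemLp (fun x => v x - ζ x) 2 (volume.restrict (Ioc (0 : ℝ) 1)) :=
    hv.memLp.sub hζ.memLp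
  refine add_le_add (Real.le_sqrt_of_sq_le ?_) ?_
  · rw [l2Norm_sq _ hm, fourierHat_trigPoly_sub hv hζ.memLp]
    refine (sobSq_sub_le zero_le_one hμ hN hζ.sobSummable hζM
      fun k hk => hv.fourierHat_eq_zero hk).trans (add_le_add_left ?_ _)
    simp only [sobWt_zero, one_mul]
    exact (sum_fst_le_energy hs).trans hE
  · rw [sobolevNorm_eq, fourierHat_trigPoly_sub hw hu.memLp]
    refine Real.sqrt_le_sqrt ((sobSq_sub_le le_rfl hμ hN hu.sobSummable huM
      fun k hk => hw.fourierHat_eq_zero hk).trans (add_le_add_left ?_ _))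
    refine le_trans (Finset.sum_le_sum fun k _ => ?_) ((sum_snd_le_energy hs).trans
      (div_le_div_of_nonneg_right hE hs.const_pos.le))
    rw [mul_pow]
    exact mul_le_mul_of_nonneg_right (sobWt_one_le k) (sq_nonneg _)

/-- A bound without a rate, from continuity on a compact interval, for the finitely many `N` to
which the smallness condition need not apply. -/
theorem IsCoeffSolution.exists_energy_bound {α β D : ℤ → ℝ} {l T μ M : ℝ} {N : ℕ}
    {Z₀ U₀ : ℤ → ℂ} {Z U z w : ℝ → ℤ → ℂ} (hex : IsExactCoeff α β D l T μ M Z U)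
    (h : IsCoeffSolution α β D l T N Z₀ U₀ z w) :
    ∃ η, ∀ t ∈ Icc 0 T, energy α β D N (Z t) (U t) (z t) (w t) ≤ η := by
  have hc : ContinuousOn (fun t => energy α β D N (Z t) (U t) (z t) (w t)) (Icc 0 T) := fun t ht =>
    (hasDerivWithinAt_energy (fun k _ => hex.deriv_fst t ht k) (fun k _ => hex.deriv_snd t ht k)
      (h.deriv_fst t ht) (h.deriv_snd t ht)).continuousWithinAt
  obtain ⟨η, hη⟩ := isCompact_Icc.exists_bound_of_continuousOn hc
  exact ⟨η, fun t ht => (le_abs_self _).trans (hη t ht)⟩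

/-- The left side is a multiple of `N^{3-2μ}`, a negative power of `N`. -/
theorem eventually_smallness {μ : ℝ} (hμ : 3 / 2 < μ) (B : ℝ) {g₀ : ℝ} (hg : 0 < g₀) :
    ∃ N₀ : ℕ, ∀ N : ℕ, 1 ≤ N → N₀ ≤ N → 3 * N * (((N : ℝ) ^ (1 - μ)) ^ 2 * B) ≤ g₀ := by
  have h : Tendsto (fun N : ℕ => 3 * B * (N : ℝ) ^ (-(2 * μ - 3))) atTop (𝓝 (3 * B * 0)) :=
    ((tendsto_rpow_neg_atTop (by linarith)).comp tendsto_natCast_atTop_atTop).const_mul _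
  rw [mul_zero] at h
  obtain ⟨N₀, hN₀⟩ := eventually_atTop.mp (h.eventually (gt_mem_nhds hg))
  refine ⟨N₀, fun N hN hN' => le_trans (le_of_eq ?_) (hN₀ N hN').le⟩
  have hpos : (0 : ℝ) < N := by exact_mod_cast hN
  have e : (N : ℝ) ^ (-(2 * μ - 3)) = N * ((N : ℝ) ^ (1 - μ)) ^ 2 := by
    rw [← Real.rpow_natCast ((N : ℝ) ^ (1 - μ)), ← Real.rpow_mul hpos.le]
    nth_rewrite 2 [← Real.rpow_one (N : ℝ)]
    rw [← Real.rpow_add hpos]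
    congr 1
    push_cast
    ring
  rw [e]
  ring

end BoussinesqSpectral

end

open BoussinesqSpectral
/-- Error estimate for the semidiscretization in the case `b = 0`, `d > 0`, `a, c < 0`. The
constants `C`, `N₀` may depend on everything except `N`. The last conjunct records the rates of
the projection error, with which the rate `N^{1-μ}` is compared: it is the same in `H¹`, and one
power of `N` worse in `L²`. -/
theorem mainTheorem3 (γ δ a b c d T μ : ℝ)
    (hγ₀ : 0 ≤ γ) (hγ₁ : γ < 1) (hδ : 0 < δ)
    (hb : b = 0) (hd : 0 < d) (ha : a < 0) (hc : c < 0)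
    (hT : 0 < T) (hμ : 3 / 2 < μ)
    (ζ₀ u₀ : ℝ → ℝ) (ζ u ζt ut : ℝ → ℝ → ℝ)
    (hζ : IsC1Sobolev T μ ζ ζt) (hu : IsC1Sobolev T μ u ut)
    (hsol : IsSolution γ δ a b c d T ζ₀ u₀ ζ u ζt ut) :
    (∃ C : ℝ, ∃ N₀ : ℕ, ∀ N : ℕ, 1 ≤ N →
      (N₀ ≤ N → ∃ ζN uN : ℝ → ℝ → ℝ, IsGalerkinSolution γ δ a b c d T ζ₀ u₀ N ζN uN) ∧
      (∀ ζN uN ζN' uN' : ℝ → ℝ → ℝ,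
        IsGalerkinSolution γ δ a b c d T ζ₀ u₀ N ζN uN →
        IsGalerkinSolution γ δ a b c d T ζ₀ u₀ N ζN' uN' →
        ∀ t ∈ Set.Icc 0 T, ζN t = ζN' t ∧ uN t = uN' t) ∧
      (∀ ζN uN : ℝ → ℝ → ℝ, IsGalerkinSolution γ δ a b c d T ζ₀ u₀ N ζN uN →
        ∀ t ∈ Set.Icc 0 T,
          l2Norm (fun x => ζN t x - ζ t x) + sobolevNorm 1 (fun x => uN t x - u t x)
            ≤ C * (N : ℝ) ^ (1 - μ))) ∧
    (∃ C : ℝ, ∀ v : ℝ → ℝ, MemSobolev μ v → ∀ N : ℕ, 1 ≤ N →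
      sobolevNorm 1 (fun x => v x - trigProj N v x) ≤ C * (N : ℝ) ^ (1 - μ) * sobolevNorm μ v ∧
      l2Norm (fun x => v x - trigProj N v x) ≤ C * (N : ℝ) ^ (-μ) * sobolevNorm μ v) := by
  have hμ1 : 1 ≤ μ := by linarith
  have hμ0 : 0 ≤ μ := by linarith
  refine ⟨?_, 1, fun v hv N hN => by simpa using projection_error hμ1 hv hN⟩
  obtain ⟨ρ, g₀, hs⟩ := exists_isSymbol hγ₀ hγ₁ hδ hd ha hc
  obtain ⟨M, hex⟩ := exists_isExactCoeff hb hd hμ0 hζ hu hsol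
  have eζ : fourierHat ζ₀ = fourierHat (ζ 0) :=
    funext fun k => (fourierHat_congr_ae hsol.init_fst k).symm
  have eu : fourierHat u₀ = fourierHat (u 0) :=
    funext fun k => (fourierHat_congr_ae hsol.init_snd k).symm
  set κ := growthRate (lam γ δ) μ M ρ g₀ with hκ
  obtain ⟨N₀, hN₀⟩ := eventually_smallness hμ (Real.exp (κ * T)) hs.const_pos
  have trig1 : ∀ {N ζN uN}, IsGalerkinSolution γ δ a b c d T ζ₀ u₀ N ζN uN → ∀ t ∈ Set.Icc 0 T,
      IsTrigPoly N (ζN t) (fourierHat (ζN t)) := fun h t ht => isTrigPoly_of_mem (h.mem_fst t ht)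
  have trig2 : ∀ {N ζN uN}, IsGalerkinSolution γ δ a b c d T ζ₀ u₀ N ζN uN → ∀ t ∈ Set.Icc 0 T,
      IsTrigPoly N (uN t) (fourierHat (uN t)) := fun h t ht => isTrigPoly_of_mem (h.mem_snd t ht)
  have uniq : ∀ {N : ℕ} (ζN uN ζN' uN' : ℝ → ℝ → ℝ),
      IsGalerkinSolution γ δ a b c d T ζ₀ u₀ N ζN uN →
      IsGalerkinSolution γ δ a b c d T ζ₀ u₀ N ζN' uN' →
      ∀ t ∈ Set.Icc 0 T, ζN t = ζN' t ∧ uN t = uN' t := by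
    intro N ζN uN ζN' uN' h h' t ht
    obtain ⟨e1, e2⟩ := (h.coeff hT hb hd).unique (h'.coeff hT hb hd) ht
    constructor
    · funext x
      rw [← Complex.ofReal_inj, trig1 h t ht x, trig1 h' t ht x, e1]
    · funext x
      rw [← Complex.ofReal_inj, trig2 h t ht x, trig2 h' t ht x, e2]
  -- The bound must be chosen before the solution; by uniqueness, the bound for one solution serves
  -- all of them.
  have bound : ∀ N : ℕ, ∃ B : ℝ, 1 ≤ N → ∀ ζN uN : ℝ → ℝ → ℝ,
      IsGalerkinSolution γ δ a b c d T ζ₀ u₀ N ζN uN → ∀ t ∈ Set.Icc 0 T,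
        l2Norm (fun x => ζN t x - ζ t x) + sobolevNorm 1 (fun x => uN t x - u t x) ≤ B := by
    intro N
    by_cases hsolN : ∃ ζN uN : ℝ → ℝ → ℝ, IsGalerkinSolution γ δ a b c d T ζ₀ u₀ N ζN uN
    · obtain ⟨ζN', uN', h'⟩ := hsolN
      obtain ⟨η, hη⟩ := (h'.coeff hT hb hd).exists_energy_bound hex
      refine ⟨Real.sqrt (η + ((N : ℝ) ^ (1 - μ)) ^ 2 * M)
        + Real.sqrt (η / g₀ + ((N : ℝ) ^ (1 - μ)) ^ 2 * M), fun hN ζN uN h t ht => ?_⟩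
      obtain ⟨e1, e2⟩ := uniq ζN uN ζN' uN' h h' t ht
      rw [e1, e2]
      exact error_le_of_energy_le hs hμ1 hN (hζ.mem t ht) (hu.mem t ht) (hex.bound_fst t ht)
        (hex.bound_snd t ht) (trig1 h' t ht) (trig2 h' t ht) (hη t ht)
    · exact ⟨0, fun _ ζN uN h => absurd ⟨ζN, uN, h⟩ hsolN⟩
  choose B hB using bound
  set C₀ := Real.sqrt (Real.exp (|κ| * T) + M) + Real.sqrt (Real.exp (|κ| * T) / g₀ + M) with hC₀
  have hsum : ∀ s : Finset ℕ, 0 ≤ ∑ n ∈ s, |B n| / (n : ℝ) ^ (1 - μ) := fun s =>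
    Finset.sum_nonneg fun n _ => by positivity
  -- `C₀` serves `N ≥ N₀`; each smaller `n` contributes its own bound divided by the rate, the sum
  -- standing in for a maximum.
  refine ⟨C₀ + ∑ n ∈ Finset.range N₀, |B n| / (n : ℝ) ^ (1 - μ), N₀, fun N hN =>
    ⟨fun hNN => ?_, uniq, fun ζN uN h t ht => ?_⟩⟩
  · obtain ⟨z, w, hzw⟩ := exists_isCoeffSolution hs hT hμ hN (hN₀ N hN hNN) hex
      (fun k => (conj_fourierHat _ k).symm) (fun k => (conj_fourierHat _ k).symm)
    simp only [← eζ, ← eu] at hzw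
    exact ⟨_, _, hzw.galerkin hT hb hd⟩
  · have hNpos : (0 : ℝ) < N := by exact_mod_cast hN
    have hε : 0 < (N : ℝ) ^ (1 - μ) := Real.rpow_pos_of_pos hNpos _
    by_cases hNN : N₀ ≤ N
    · have hco := h.coeff hT hb hd
      rw [eζ, eu] at hco
      have hE := hco.energy_le hs hT hμ hN (hN₀ N hN hNN) hex ht
      have hE' : energy (symFst γ δ a) (symSnd γ c) (symD d) N (fourierHat (ζ t))
          (fourierHat (u t)) (fourierHat (ζN t)) (fourierHat (uN t))
          ≤ ((N : ℝ) ^ (1 - μ)) ^ 2 * Real.exp (|κ| * T) := by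
        refine hE.trans (mul_le_mul_of_nonneg_left (Real.exp_le_exp.mpr ?_) (sq_nonneg _))
        exact mul_le_mul (le_abs_self κ) ht.2 ht.1 (abs_nonneg κ)
      have herr := error_le_of_energy_le hs hμ1 hN (hζ.mem t ht) (hu.mem t ht)
        (hex.bound_fst t ht) (hex.bound_snd t ht) (trig1 h t ht) (trig2 h t ht) hE'
      -- Both radicands contain the factor `N^{2(1-μ)}`, whose root is the rate; what remains is
      -- `C₀`.
      rw [mul_div_assoc, ← mul_add, ← mul_add, Real.sqrt_mul (sq_nonneg _),
        Real.sqrt_mul (sq_nonneg _), Real.sqrt_sq hε.le, ← mul_add, mul_comm] at herr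
      exact herr.trans (mul_le_mul_of_nonneg_right (le_add_of_nonneg_right (hsum _)) hε.le)
    · refine (hB N hN ζN uN h t ht).trans ((le_abs_self _).trans ?_)
      rw [← div_le_iff₀ hε]
      refine (Finset.single_le_sum (f := fun n : ℕ => |B n| / (n : ℝ) ^ (1 - μ))
        (fun n _ => by positivity) (Finset.mem_range.mpr (not_le.mp hNN))).trans ?_
      exact le_add_of_nonneg_left (by positivity)
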